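/- Let $C=\mathrm{Spec}\,A$ be an affine nodal curve over $\mathbb{C}$, that is, $A$ is a reduced $\mathbb{C}$-algebra of finite type, $C$ is of pure dimension one (possibly reducible or disconnected), and every closed point of $C$ is either smooth or a node (the completed local ring is isomorphic to $\mathbb{C}[[x,y]]/(xy)$ as a $\mathbb{C}$-algebra). Let $p\neq q$ be two distinct smooth closed points of $C$. Let $G$ be a semisimple algebraic group over $\mathbb{C}$, that is, a smooth connected affine algebraic group whose only Zariski-closed connected solvable normal subgroup is the trivial one. Then for every $g\in G(\mathbb{C})$ there is $\gamma\in G(A)$ (that is, a morphism of $\mathbb{C}$-schemes $\gamma\colon C\to G$) such that $\gamma(p)=1$ and $\gamma(q)=g$. -/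

import Mathlib

namespace AffineNodal

/-- The group `G(R)` of `R`-points of the affine algebraic group `G = Spec H` over `ℂ`, where `H` is
a commutative Hopf algebra over `ℂ`.  A point is a `ℂ`-algebra homomorphism `H → R`; the group law
is convolution, that is, `x * y` is the composite of the comultiplication of `H` with
`a ⊗ b ↦ x a * y b`, and the unit is the composite of the counit with `ℂ → R`. -/
abbrev Points (H : Type*) [CommRing H] [HopfAlgebra ℂ H] (R : Type*) [CommRing R] [Algebra ℂ R] :
    Type _ :=
  WithConv (H →ₐ[ℂ] R)

/-- The map `G(R) → G(S)` induced by a homomorphism of `ℂ`-algebras `φ : R → S`.  If `R` is the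
coordinate ring of an affine scheme `C` and `S = ℂ`, then `φ` is a `ℂ`-point of `C`, an element
`γ` of `G(R)` is a morphism `C → G`, and `Points.map H φ γ` is the value of `γ` at `φ`. -/
def Points.map (H : Type*) [CommRing H] [HopfAlgebra ℂ H] {R S : Type*} [CommRing R] [CommRing S]
    [Algebra ℂ R] [Algebra ℂ S] (φ : R →ₐ[ℂ] S) (γ : Points H R) : Points H S :=
  WithConv.toConv (φ.comp γ.ofConv)

/-- The Zariski topology on `G(ℂ)`: it is induced from that of `Spec H` by sending a point to the
maximal ideal of the functions that vanish at it. -/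
abbrev zariskiTopology (H : Type*) [CommRing H] [HopfAlgebra ℂ H] : TopologicalSpace (Points H ℂ) :=
  TopologicalSpace.induced
    (fun x => (⟨RingHom.ker x.ofConv, RingHom.ker_isPrime x.ofConv⟩ : PrimeSpectrum H)) inferInstance

/-- The algebraic group `G = Spec H` over `ℂ` is semisimple: it is affine (by construction), smooth
(in particular of finite type) and connected, and its radical is trivial, that is, the trivial
subgroup is the only Zariski-closed, connected, solvable, normal subgroup of `G(ℂ)`. -/
structure IsSemisimple (H : Type*) [CommRing H] [HopfAlgebra ℂ H] : Prop where
  smooth : Algebra.Smooth ℂ H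
  connected : ConnectedSpace (PrimeSpectrum H)
  radical_trivial : ∀ N : Subgroup (Points H ℂ), N.Normal →
    @IsClosed _ (zariskiTopology H) (N : Set (Points H ℂ)) →
    @IsConnected _ (zariskiTopology H) (N : Set (Points H ℂ)) →
    Group.IsSolvable N → N = ⊥

/-- The closed point `𝔪` of `Spec A` is a node (ordinary double point): the completion of the local
ring `A_𝔪` is isomorphic, as a `ℂ`-algebra, to `ℂ⟦x, y⟧ / (x y)`. -/
def IsNode (A : Type*) [CommRing A] [Algebra ℂ A] (𝔪 : Ideal A) [𝔪.IsPrime] : Prop :=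
  Nonempty
    (AdicCompletion (IsLocalRing.maximalIdeal (Localization.AtPrime 𝔪)) (Localization.AtPrime 𝔪)
      ≃ₐ[ℂ] (MvPowerSeries (Fin 2) ℂ ⧸
        Ideal.span {(MvPowerSeries.X 0 * MvPowerSeries.X 1 : MvPowerSeries (Fin 2) ℂ)}))

/-- `Spec A` is a nodal curve over `ℂ`: it is reduced, of finite type and of pure dimension one
(possibly reducible or disconnected), and every closed point is smooth or a node. -/
structure IsNodalCurve (A : Type*) [CommRing A] [Algebra ℂ A] : Prop where
  finiteType : Algebra.FiniteType ℂ A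
  reduced : IsReduced A
  pure_dim_one : ∀ P ∈ minimalPrimes A, ringKrullDim (A ⧸ P) = 1
  smooth_or_node : ∀ (𝔪 : Ideal A) [𝔪.IsMaximal], Algebra.IsSmoothAt ℂ 𝔪 ∨ IsNode A 𝔪

/-- The `ℂ`-point `p` of `Spec A` (equivalently, by the Nullstellensatz, the closed point `ker p`)
is a smooth point. -/
def IsSmoothPoint {A : Type*} [CommRing A] [Algebra ℂ A] (p : A →ₐ[ℂ] ℂ) : Prop :=
  haveI := RingHom.ker_isPrime p
  Algebra.IsSmoothAt ℂ (RingHom.ker p)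

end AffineNodal

/-! The values at `q` of morphisms `Spec A → G` sending `p` to `1` form a subgroup of `G(ℂ)`, called
`reachable`. If `y` in the Lie algebra is nilpotent in every finite-dimensional subcomodule of `H`,
then `t ↦ exp(t y)` is polynomial. For a regular function `a` with `a(p) = 0` and `a(q) = 1`, the
point `exp(s a y)` of `G(A)` then joins `1` to `exp(s y)`. It remains to see that products of such
exponentials fill a nonempty open set, since a subgroup containing one is everything when `G` is
connected (`eq_top_of_forall_ne_zero_mem`).

Semisimplicity provides enough nilpotents. Exponentiating a characteristic abelian ideal of the Lie
algebra and taking the Zariski closure gives a closed connected solvable normal subgroup, so the Lie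
algebra has trivial radical (`hasTrivialRadical_lieAlg`). The nilpotents span an ideal modulo which
every `ad x` is nilpotent. By Engel, a complementary ideal is nilpotent, hence zero
(`nilSpan_eq_top`).

For a basis of nilpotents, `(s₁, …, s_N) ↦ exp(s₁ y₁) ⋯ exp(s_N y_N)` is the identity to first order
at the origin. A function killed by it vanishes to infinite order at `1`, hence near `1` by Krull
and Nakayama (`exists_mul_eq_zero_of_nilExpProd_eq_zero`). Chevalley's theorem then puts an open set
in the image (`reachable_eq_top`). -/

namespace AffineNodal

open TensorProduct Coalgebra WithConv

/-! ### The convolution algebra of functionals and its locally finite action on `H`. -/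

section Convolution

variable {H : Type*} [CommRing H] [HopfAlgebra ℂ H]

/-- The convolution algebra of linear functionals on the coordinate ring `H`. -/
abbrev ConvDual (H : Type*) [CommRing H] [HopfAlgebra ℂ H] : Type _ := WithConv (H →ₗ[ℂ] ℂ)

/-- Right translation by a functional: `f ↦ f₍₁₎ φ(f₍₂₎)`. -/
noncomputable def rightTrans (φ : ConvDual H) : H →ₗ[ℂ] H :=
  (TensorProduct.rid ℂ H).toLinearMap ∘ₗ (φ.ofConv).lTensor H ∘ₗ comul

/-- Left translation by a functional: `f ↦ φ(f₍₁₎) f₍₂₎`. -/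
noncomputable def leftTrans (φ : ConvDual H) : H →ₗ[ℂ] H :=
  (TensorProduct.lid ℂ H).toLinearMap ∘ₗ (φ.ofConv).rTensor H ∘ₗ comul

lemma rightTrans_eq_sum (φ : ConvDual H) {f : H} {ι : Type*} (r : Coalgebra.Repr ℂ f ι) :
    rightTrans φ f = ∑ i ∈ r.index, φ (r.right i) • r.left i := by
  simp [rightTrans, ← r.eq, map_sum]

lemma leftTrans_eq_sum (φ : ConvDual H) {f : H} {ι : Type*} (r : Coalgebra.Repr ℂ f ι) :
    leftTrans φ f = ∑ i ∈ r.index, φ (r.left i) • r.right i := by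
  simp [leftTrans, ← r.eq, map_sum]

/-- With its left analogue, this replaces coproduct manipulations by associativity of convolution,
because functionals separate the elements of `H`. -/
lemma mul_apply_rightTrans (ψ φ : ConvDual H) (f : H) : (ψ * φ) f = ψ (rightTrans φ f) := by
  rw [(ℛ ℂ f).convMul_apply, rightTrans_eq_sum φ (ℛ ℂ f), map_sum]
  simp [mul_comm]

lemma mul_apply_leftTrans (φ ψ : ConvDual H) (f : H) : (φ * ψ) f = ψ (leftTrans φ f) := by
  rw [(ℛ ℂ f).convMul_apply, leftTrans_eq_sum φ (ℛ ℂ f), map_sum]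
  simp

lemma convDual_one_apply (f : H) : (1 : ConvDual H) f = counit (R := ℂ) f := rfl

lemma convDual_ext {φ ψ : ConvDual H} (h : ∀ f, φ f = ψ f) : φ = ψ :=
  WithConv.ext (LinearMap.ext h)

lemma eq_of_forall_convDual {f g : H} (h : ∀ φ : ConvDual H, φ f = φ g) : f = g := by
  rw [← sub_eq_zero, ← Module.forall_dual_apply_eq_zero_iff ℂ]
  intro φ
  simpa [sub_eq_zero] using h (toConv φ)

lemma rightTrans_mul (φ ψ : ConvDual H) (f : H) :
    rightTrans (φ * ψ) f = rightTrans φ (rightTrans ψ f) :=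
  eq_of_forall_convDual fun z ↦ by
    rw [← mul_apply_rightTrans, ← mul_apply_rightTrans, ← mul_apply_rightTrans, mul_assoc]

variable (H) in
/-- Right translation as a representation of the convolution algebra on `H`. -/
noncomputable def rightTransHom : ConvDual H →ₐ[ℂ] Module.End ℂ H :=
  AlgHom.ofLinearMap
    { toFun := rightTrans
      map_add' := fun φ ψ ↦ by
        ext f
        simp [rightTrans_eq_sum _ (ℛ ℂ f), add_smul, Finset.sum_add_distrib]
      map_smul' := fun c φ ↦ by
        ext f
        simp [rightTrans_eq_sum _ (ℛ ℂ f), mul_smul, Finset.smul_sum] }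
    (by
      ext f
      exact eq_of_forall_convDual fun z ↦ by
        change z (rightTrans 1 f) = z f
        rw [← mul_apply_rightTrans, mul_one])
    (fun φ ψ ↦ LinearMap.ext fun f ↦ rightTrans_mul φ ψ f)

@[simp] lemma rightTransHom_apply (φ : ConvDual H) (f : H) :
    rightTransHom H φ f = rightTrans φ f := rfl

/-- The subcomodule of `H` generated by `f`: the span of its right translates. -/
noncomputable def orbitSpan (f : H) : Submodule ℂ H :=
  LinearMap.range ((LinearMap.applyₗ f) ∘ₗ (rightTransHom H).toLinearMap)

lemma self_mem_orbitSpan (f : H) : f ∈ orbitSpan f :=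
  ⟨1, by simp⟩

lemma rightTrans_mem_orbitSpan_of_mem (φ : ConvDual H) {f g : H} (hg : g ∈ orbitSpan f) :
    rightTrans φ g ∈ orbitSpan f := by
  obtain ⟨ψ, rfl⟩ := hg
  exact ⟨φ * ψ, rightTrans_mul φ ψ f⟩

/-- One fixed expression of `Δ f` serves for all functionals, so its finitely many left factors span
every translate. -/
instance finiteDimensional_orbitSpan (f : H) : FiniteDimensional ℂ (orbitSpan f) := by
  classical
  have h : orbitSpan f ≤ Submodule.span ℂ (((ℛ ℂ f).index.image (ℛ ℂ f).left : Finset H) : Set H) := by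
    rintro _ ⟨φ, rfl⟩
    change rightTrans φ f ∈ _
    rw [rightTrans_eq_sum φ (ℛ ℂ f)]
    exact Submodule.sum_mem _ fun i hi ↦ Submodule.smul_mem _ _
      (Submodule.subset_span (by exact_mod_cast Finset.mem_image_of_mem _ hi))
  exact Submodule.finiteDimensional_of_le h

/-- The representation of the convolution algebra on the subcomodule generated by `f`. -/
noncomputable def orbitRep (f : H) : ConvDual H →ₐ[ℂ] Module.End ℂ (orbitSpan f) :=
  AlgHom.ofLinearMap
    { toFun := fun φ ↦ (rightTransHom H φ).restrict
        fun _ hg ↦ rightTrans_mem_orbitSpan_of_mem φ hg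
      map_add' := fun φ ψ ↦ LinearMap.ext fun g ↦ Subtype.ext <|
        LinearMap.congr_fun (map_add (rightTransHom H) φ ψ) g
      map_smul' := fun c φ ↦ LinearMap.ext fun g ↦ Subtype.ext <|
        LinearMap.congr_fun (map_smul (rightTransHom H) c φ) g }
    (LinearMap.ext fun g ↦ Subtype.ext <| LinearMap.congr_fun (map_one (rightTransHom H)) g)
    (fun φ ψ ↦ LinearMap.ext fun g ↦ Subtype.ext <|
      LinearMap.congr_fun (map_mul (rightTransHom H) φ ψ) g)

lemma coe_orbitRep_apply (f : H) (φ : ConvDual H) (g : orbitSpan f) :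
    (orbitRep f φ g : H) = rightTrans φ g := rfl

/-- Values of functionals are matrix coefficients of a finite-dimensional representation;
convergence and nilpotency are reduced to matrices this way. -/
lemma apply_eq_counit_orbitRep (f : H) (φ : ConvDual H) :
    φ f = counit (R := ℂ) (orbitRep f φ ⟨f, self_mem_orbitSpan f⟩ : H) := by
  rw [coe_orbitRep_apply, ← convDual_one_apply, ← mul_apply_rightTrans, one_mul]

end Convolution

/-! ### Point derivations at the identity and their divided powers. -/

section LieAlgebra

variable {H : Type*} [CommRing H] [HopfAlgebra ℂ H]

noncomputable instance : LieRing (ConvDual H) := LieRing.ofAssociativeRing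

variable (H) in
/-- The Lie algebra of the algebraic group `Spec H`: the point derivations at the identity, with the
commutator bracket of the convolution algebra. -/
noncomputable def lieAlg : LieSubalgebra ℂ (ConvDual H) where
  carrier := {x | ∀ a b : H, x (a * b) = counit (R := ℂ) a * x b + x a * counit (R := ℂ) b}
  add_mem' := fun {x y} hx hy a b ↦ by
    simp only [ofConv_add, LinearMap.add_apply, hx a b, hy a b]; ring
  zero_mem' := fun a b ↦ by simp
  smul_mem' := fun c x hx a b ↦ by
    simp only [ofConv_smul, LinearMap.smul_apply, hx a b, smul_eq_mul]; ring
  lie_mem' := fun {x y} hx hy a b ↦ by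
    -- A product of two derivations obeys the Leibniz rule up to a cross term symmetric in `x` and
    -- `y`, which the commutator cancels.
    have key : ∀ x y : ConvDual H,
        (∀ a b : H, x (a * b) = counit (R := ℂ) a * x b + x a * counit (R := ℂ) b) →
        (∀ a b : H, y (a * b) = counit (R := ℂ) a * y b + y a * counit (R := ℂ) b) →
        (x * y) (a * b) = counit (R := ℂ) a * (x * y) b + (x * y) a * counit (R := ℂ) b
          + (x a * y b + y a * x b) := by
      intro x y hx hy
      -- Padding with the convolution unit writes every factor as a sum over the same
      -- representations of `Δ a` and `Δ b`, so that the identity can be checked termwise.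
      have e1 : x a = (x * 1) a := by rw [mul_one]
      have e2 : x b = (x * 1) b := by rw [mul_one]
      have e3 : y a = (1 * y) a := by rw [one_mul]
      have e4 : y b = (1 * y) b := by rw [one_mul]
      have e5 : counit (R := ℂ) a = (1 * 1 : ConvDual H) a := by rw [mul_one]; rfl
      have e6 : counit (R := ℂ) b = (1 * 1 : ConvDual H) b := by rw [mul_one]; rfl
      rw [e1, e2, e3, e4, e5, e6, ((ℛ ℂ a).mul (ℛ ℂ b)).convMul_apply]
      simp only [(ℛ ℂ a).convMul_apply, (ℛ ℂ b).convMul_apply]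
      simp only [Coalgebra.Repr.mul_index, Coalgebra.Repr.mul_left, Coalgebra.Repr.mul_right,
        Finset.sum_product, hx, hy, convDual_one_apply,
        Finset.sum_mul_sum, ← Finset.sum_add_distrib]
      refine Finset.sum_congr rfl fun i _ ↦ Finset.sum_congr rfl fun j _ ↦ ?_
      ring
    simp only [Ring.lie_def, ofConv_sub, LinearMap.sub_apply, key x y hx hy, key y x hy hx]
    ring

lemma lieAlg_apply_mul {x : ConvDual H} (hx : x ∈ lieAlg H) (a b : H) :
    x (a * b) = counit (R := ℂ) a * x b + x a * counit (R := ℂ) b := hx a b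

lemma lieAlg_apply_one {x : ConvDual H} (hx : x ∈ lieAlg H) : x (1 : H) = 0 := by
  simpa using lieAlg_apply_mul hx 1 1

/-- The invariant vector field attached to a tangent vector at the identity. -/
lemma rightTrans_apply_mul {x : ConvDual H} (hx : x ∈ lieAlg H) (a b : H) :
    rightTrans x (a * b) = a * rightTrans x b + rightTrans x a * b := by
  have h1 : ∀ c : H, rightTrans 1 c = c := fun c ↦ LinearMap.congr_fun (map_one (rightTransHom H)) c
  conv_rhs => rw [← h1 a, ← h1 b, h1 a, h1 b]
  nth_rewrite 2 [← h1 a]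
  nth_rewrite 3 [← h1 b]
  rw [rightTrans_eq_sum x ((ℛ ℂ a).mul (ℛ ℂ b))]
  simp only [rightTrans_eq_sum _ (ℛ ℂ a), rightTrans_eq_sum _ (ℛ ℂ b)]
  simp only [Coalgebra.Repr.mul_index, Coalgebra.Repr.mul_left, Coalgebra.Repr.mul_right,
    Finset.sum_product, lieAlg_apply_mul hx, convDual_one_apply, Finset.sum_mul_sum,
    ← Finset.sum_add_distrib]
  refine Finset.sum_congr rfl fun i _ ↦ Finset.sum_congr rfl fun j _ ↦ ?_
  simp only [smul_mul_smul_comm, ← add_smul]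

open Finset in
-- Multiplication intertwines `D ⊗ 1 + 1 ⊗ D` with `D`, and the two summands commute, so the
-- binomial theorem applies.
lemma rightTrans_pow_apply_mul {x : ConvDual H} (hx : x ∈ lieAlg H) (n : ℕ) (a b : H) :
    rightTrans (x ^ n) (a * b) = ∑ p ∈ antidiagonal n,
      n.choose p.1 • (rightTrans (x ^ p.1) a * rightTrans (x ^ p.2) b) := by
  set D : Module.End ℂ H := rightTransHom H x
  have hD : ∀ m c, rightTrans (x ^ m) c = (D ^ m) c := fun m c ↦
    LinearMap.congr_fun (map_pow (rightTransHom H) x m) c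
  have hc : Commute (D.rTensor H) (D.lTensor H) := by
    change D.rTensor H ∘ₗ D.lTensor H = D.lTensor H ∘ₗ D.rTensor H
    simp
  have hmul : ∀ (m : ℕ) (t : H ⊗[ℂ] H), LinearMap.mul' ℂ H (((D.rTensor H + D.lTensor H) ^ m) t) =
      (D ^ m) (LinearMap.mul' ℂ H t) := by
    intro m
    induction m with
    | zero => simp
    | succ m ih =>
      intro t
      rw [pow_succ, pow_succ, Module.End.mul_apply, Module.End.mul_apply, ih]
      congr 1
      induction t with
      | zero => simp
      | add s t hs ht => simp only [map_add, hs, ht]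
      | tmul s t =>
        simpa [D, add_comm] using (rightTrans_apply_mul hx s t).symm
  have := hmul n (a ⊗ₜ b)
  rw [hc.add_pow'] at this
  simp only [hD]
  rw [← LinearMap.mul'_apply (R := ℂ), ← this]
  simp only [LinearMap.sum_apply, map_sum, LinearMap.rTensor_pow, LinearMap.lTensor_pow,
    LinearMap.smul_apply, map_nsmul, Module.End.mul_apply, LinearMap.lTensor_tmul,
    LinearMap.rTensor_tmul, LinearMap.mul'_apply]

/-- The divided power `xⁿ / n!` of a functional, evaluated at `f`. -/
noncomputable def divPow (x : ConvDual H) (n : ℕ) (f : H) : ℂ := (n.factorial : ℂ)⁻¹ * (x ^ n) f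

open Finset in
-- Dividing by factorials absorbs the binomial coefficients. This makes both the analytic and the
-- polynomial exponential multiplicative in the function.
lemma divPow_mul {x : ConvDual H} (hx : x ∈ lieAlg H) (n : ℕ) (a b : H) :
    divPow x n (a * b) = ∑ p ∈ antidiagonal n, divPow x p.1 a * divPow x p.2 b := by
  have h : ∀ m c, (x ^ m) c = counit (R := ℂ) (rightTrans (x ^ m) c) := fun m c ↦ by
    rw [← convDual_one_apply, ← mul_apply_rightTrans, one_mul]
  simp only [divPow, h, rightTrans_pow_apply_mul hx, map_sum, mul_sum]
  refine sum_congr rfl fun p hp ↦ ?_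
  rw [HasAntidiagonal.mem_antidiagonal] at hp
  subst hp
  have h1 : ((p.1 + p.2).choose p.1 : ℂ) * p.1.factorial * p.2.factorial =
      (p.1 + p.2).factorial := by
    rw [Nat.choose_symm_add]
    exact_mod_cast Nat.add_choose_mul_factorial_mul_factorial p.1 p.2
  have h2 : (p.1.factorial : ℂ) ≠ 0 := by exact_mod_cast p.1.factorial_ne_zero
  have h3 : (p.2.factorial : ℂ) ≠ 0 := by exact_mod_cast p.2.factorial_ne_zero
  have h4 : ((p.1 + p.2).factorial : ℂ) ≠ 0 := by exact_mod_cast (p.1 + p.2).factorial_ne_zero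
  rw [map_nsmul, Bialgebra.counit_mul, nsmul_eq_mul]
  field_simp
  rw [← h1]
  ring

lemma divPow_zero (x : ConvDual H) (f : H) : divPow x 0 f = counit (R := ℂ) f := by
  simp [divPow]

lemma divPow_one (x : ConvDual H) (f : H) : divPow x 1 f = x f := by simp [divPow]

lemma divPow_add_apply (x : ConvDual H) (n : ℕ) (f g : H) :
    divPow x n (f + g) = divPow x n f + divPow x n g := by
  simp [divPow, mul_add]

lemma divPow_apply_smul (x : ConvDual H) (n : ℕ) (c : ℂ) (f : H) :
    divPow x n (c • f) = c * divPow x n f := by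
  simp [divPow]; ring

lemma divPow_apply_one {x : ConvDual H} (hx : x ∈ lieAlg H) (n : ℕ) :
    divPow x n (1 : H) = if n = 0 then 1 else 0 := by
  cases n with
  | zero => simp [divPow_zero]
  | succ n =>
    have h1 : rightTrans x (1 : H) = 0 := by
      simpa using rightTrans_apply_mul hx 1 1
    simp only [divPow, pow_succ, mul_apply_rightTrans, h1, map_zero, mul_zero]
    simp

/-- A point derivation is determined by its values on a finite set of algebra generators. -/
lemma finiteDimensional_lieAlg [Algebra.FiniteType ℂ H] : FiniteDimensional ℂ (lieAlg H) := by
  obtain ⟨S, hS⟩ := Algebra.FiniteType.out (R := ℂ) (A := H)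
  let e : lieAlg H →ₗ[ℂ] (S → ℂ) :=
    { toFun := fun x s ↦ x.1 s
      map_add' := fun x y ↦ rfl
      map_smul' := fun c x ↦ rfl }
  refine FiniteDimensional.of_injective e ((injective_iff_map_eq_zero e).2 fun x hx ↦ ?_)
  refine Subtype.ext (convDual_ext fun f ↦ ?_)
  have hf : f ∈ Algebra.adjoin ℂ (S : Set H) := hS ▸ Algebra.mem_top
  change x.1 f = 0
  induction hf using Algebra.adjoin_induction with
  | mem s hs => exact congr_fun hx ⟨s, hs⟩
  | algebraMap r => rw [Algebra.algebraMap_eq_smul_one, map_smul, lieAlg_apply_one x.2, smul_zero]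
  | add a b _ _ ha hb => rw [map_add, ha, hb, add_zero]
  | mul a b _ _ ha hb => rw [lieAlg_apply_mul x.2, ha, hb]; simp

end LieAlgebra

/-! ### The exponential map and the adjoint action. -/

section Exponential

variable {H : Type*} [CommRing H] [HopfAlgebra ℂ H]

lemma hasDerivAt_exp_smul_zero {𝔸 : Type*} [NormedRing 𝔸] [NormedAlgebra ℂ 𝔸] [CompleteSpace 𝔸]
    (T : 𝔸) : HasDerivAt (fun u : ℂ ↦ NormedSpace.exp (u • T)) T 0 := by
  simpa using hasDerivAt_exp_smul_const (𝕂 := ℂ) T 0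

/-- The powers of a functional `x`, evaluated at a fixed function, are matrix coefficients of the
powers of an operator on a finite-dimensional space. -/
lemma exists_matrixCoeff (x : ConvDual H) (f : H) :
    ∃ (d : ℕ) (T : EuclideanSpace ℂ (Fin d) →L[ℂ] EuclideanSpace ℂ (Fin d))
      (l : (EuclideanSpace ℂ (Fin d) →L[ℂ] EuclideanSpace ℂ (Fin d)) →L[ℂ] ℂ),
      ∀ n : ℕ, (x ^ n) f = l (T ^ n) := by
  let d := Module.finrank ℂ (orbitSpan f)
  let e : orbitSpan f ≃ₗ[ℂ] EuclideanSpace ℂ (Fin d) :=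
    LinearEquiv.ofFinrankEq _ _ (by simp [d])
  let T := LinearMap.toContinuousLinearMap (e.conj (orbitRep f x))
  let v : orbitSpan f := ⟨f, self_mem_orbitSpan f⟩
  let c : EuclideanSpace ℂ (Fin d) →ₗ[ℂ] ℂ :=
    counit (R := ℂ) ∘ₗ (orbitSpan f).subtype ∘ₗ e.symm.toLinearMap
  refine ⟨d, T, (LinearMap.toContinuousLinearMap c).comp
    (ContinuousLinearMap.apply ℂ _ (e v)), fun n ↦ ?_⟩
  have key : ∀ n : ℕ, (T ^ n) (e v) = e (orbitRep f (x ^ n) v) := by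
    intro n
    induction n with
    | zero => simp
    | succ n ih =>
      rw [pow_succ', pow_succ', mul_apply_eq_comp, ih, map_mul]
      simp [T, LinearEquiv.conj_apply]
  have h2 : (x ^ n) f = counit (R := ℂ) (orbitRep f (x ^ n) v : H) := apply_eq_counit_orbitRep f _
  rw [h2]
  change _ = c ((T ^ n) (e v))
  rw [key]
  simp [c]

lemma divPow_eq_matrixCoeff {x : ConvDual H} {f : H} {d : ℕ}
    {T : EuclideanSpace ℂ (Fin d) →L[ℂ] EuclideanSpace ℂ (Fin d)}
    {l : (EuclideanSpace ℂ (Fin d) →L[ℂ] EuclideanSpace ℂ (Fin d)) →L[ℂ] ℂ}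
    (h : ∀ n : ℕ, (x ^ n) f = l (T ^ n)) (n : ℕ) :
    divPow x n f = l ((n.factorial : ℂ)⁻¹ • T ^ n) := by
  rw [divPow, h, map_smul, smul_eq_mul]

lemma summable_norm_divPow (x : ConvDual H) (f : H) : Summable fun n ↦ ‖divPow x n f‖ := by
  obtain ⟨d, T, l, h⟩ := exists_matrixCoeff x f
  simp only [divPow_eq_matrixCoeff h]
  refine Summable.of_nonneg_of_le (fun _ ↦ norm_nonneg _) (fun n ↦ l.le_opNorm _)
    ((NormedSpace.norm_expSeries_summable' (𝕂 := ℂ) T).mul_left _)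

lemma summable_divPow (x : ConvDual H) (f : H) : Summable fun n ↦ divPow x n f :=
  (summable_norm_divPow x f).of_norm

/-- The exponential `∑ xⁿ / n!` of a functional, as a functional. -/
noncomputable def expFun (x : ConvDual H) : ConvDual H := toConv
  { toFun := fun f ↦ ∑' n, divPow x n f
    map_add' := fun f g ↦ by
      rw [← (summable_divPow x f).tsum_add (summable_divPow x g)]
      exact tsum_congr fun n ↦ divPow_add_apply x n f g
    map_smul' := fun c f ↦ by
      rw [RingHom.id_apply, smul_eq_mul, ← tsum_mul_left]
      exact tsum_congr fun n ↦ divPow_apply_smul x n c f }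

lemma expFun_apply (x : ConvDual H) (f : H) : expFun x f = ∑' n, divPow x n f := rfl

lemma hasSum_expFun (x : ConvDual H) (f : H) : HasSum (fun n ↦ divPow x n f) (expFun x f) :=
  (summable_divPow x f).hasSum

lemma expFun_smul_eq {x : ConvDual H} {f : H} {d : ℕ}
    {T : EuclideanSpace ℂ (Fin d) →L[ℂ] EuclideanSpace ℂ (Fin d)}
    {l : (EuclideanSpace ℂ (Fin d) →L[ℂ] EuclideanSpace ℂ (Fin d)) →L[ℂ] ℂ}
    (h : ∀ n : ℕ, (x ^ n) f = l (T ^ n)) (t : ℂ) :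
    expFun (t • x) f = l (NormedSpace.exp (t • T)) := by
  have h' : ∀ n : ℕ, ((t • x) ^ n) f = l ((t • T) ^ n) := fun n ↦ by
    simp [smul_pow, h]
  have hs := (NormedSpace.exp_series_hasSum_exp' (𝕂 := ℂ) (t • T)).mapL l
  refine HasSum.unique (hasSum_expFun _ f) ?_
  simpa only [divPow_eq_matrixCoeff h'] using hs

lemma hasDerivAt_expFun_smul (x : ConvDual H) (f : H) (t : ℂ) :
    ∃ D : ℂ, HasDerivAt (fun s : ℂ ↦ expFun (s • x) f) D t := by
  obtain ⟨d, T, l, h⟩ := exists_matrixCoeff x f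
  simp only [expFun_smul_eq h]
  exact ⟨_, l.hasFDerivAt.comp_hasDerivAt t (hasDerivAt_exp_smul_const (𝕂 := ℂ) T t)⟩

lemma continuous_expFun_smul (x : ConvDual H) (f : H) :
    Continuous fun s : ℂ ↦ expFun (s • x) f :=
  continuous_iff_continuousAt.2 fun t ↦ (hasDerivAt_expFun_smul x f t).choose_spec.continuousAt

lemma hasDerivAt_expFun_smul_zero (x : ConvDual H) (f : H) :
    HasDerivAt (fun s : ℂ ↦ expFun (s • x) f) (x f) 0 := by
  obtain ⟨d, T, l, h⟩ := exists_matrixCoeff x f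
  simp only [expFun_smul_eq h]
  have hx : x f = l T := by simpa using h 1
  rw [hx]
  exact l.hasFDerivAt.comp_hasDerivAt (0 : ℂ) (hasDerivAt_exp_smul_zero T)

lemma expFun_mul_apply {x : ConvDual H} (hx : x ∈ lieAlg H) (a b : H) :
    expFun x (a * b) = expFun x a * expFun x b := by
  rw [expFun_apply, expFun_apply, expFun_apply, tsum_mul_tsum_eq_tsum_sum_antidiagonal_of_summable_norm
    (summable_norm_divPow x a) (summable_norm_divPow x b)]
  exact tsum_congr fun n ↦ divPow_mul hx n a b

lemma expFun_apply_one {x : ConvDual H} (hx : x ∈ lieAlg H) : expFun x (1 : H) = 1 := by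
  rw [expFun_apply, tsum_eq_single 0 fun n hn ↦ by simp [divPow_apply_one hx, hn]]
  simp [divPow_apply_one hx]

open Finset in
-- For each term of `Δ f`, a Cauchy product of absolutely convergent series is matched with the
-- binomial expansion of `(x + y)ⁿ`.
lemma expFun_add_of_commute {x y : ConvDual H} (h : Commute x y) :
    expFun (x + y) = expFun x * expFun y := by
  refine convDual_ext fun f ↦ ?_
  rw [(ℛ ℂ f).convMul_apply]
  refine HasSum.unique (hasSum_expFun _ f) ?_
  have hs : ∀ i ∈ (ℛ ℂ f).index, HasSum
      (fun n ↦ ∑ p ∈ antidiagonal n, divPow x p.1 ((ℛ ℂ f).left i) * divPow y p.2 ((ℛ ℂ f).right i))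
      (expFun x ((ℛ ℂ f).left i) * expFun y ((ℛ ℂ f).right i)) := by
    intro i _
    have h1 := summable_norm_divPow x ((ℛ ℂ f).left i)
    have h2 := summable_norm_divPow y ((ℛ ℂ f).right i)
    rw [expFun_apply, expFun_apply, tsum_mul_tsum_eq_tsum_sum_antidiagonal_of_summable_norm h1 h2]
    exact (summable_norm_sum_mul_antidiagonal_of_summable_norm h1 h2).of_norm.hasSum
  refine (hasSum_sum hs).congr_fun fun n ↦ ?_
  have e : ∀ p ∈ antidiagonal n, ((n.factorial : ℂ)⁻¹ * n.choose p.1) =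
      (p.1.factorial : ℂ)⁻¹ * (p.2.factorial : ℂ)⁻¹ := by
    intro p hp
    rw [HasAntidiagonal.mem_antidiagonal] at hp
    subst hp
    have h1 : ((p.1 + p.2).choose p.1 : ℂ) * p.1.factorial * p.2.factorial =
        (p.1 + p.2).factorial := by
      rw [Nat.choose_symm_add]
      exact_mod_cast Nat.add_choose_mul_factorial_mul_factorial p.1 p.2
    have h2 : (p.1.factorial : ℂ) ≠ 0 := by exact_mod_cast p.1.factorial_ne_zero
    have h3 : (p.2.factorial : ℂ) ≠ 0 := by exact_mod_cast p.2.factorial_ne_zero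
    have h4 : ((p.1 + p.2).factorial : ℂ) ≠ 0 := by exact_mod_cast (p.1 + p.2).factorial_ne_zero
    field_simp
    rw [← h1]
  rw [sum_comm, divPow, h.add_pow']
  simp only [ofConv_sum, LinearMap.sum_apply, mul_sum]
  refine sum_congr rfl fun p hp ↦ ?_
  rw [ofConv_smul, LinearMap.smul_apply, nsmul_eq_mul, ← mul_assoc, e p hp,
    (ℛ ℂ f).convMul_apply, mul_sum]
  refine sum_congr rfl fun i _ ↦ ?_
  simp only [divPow]
  ring

lemma expFun_zero : expFun (0 : ConvDual H) = 1 := by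
  refine convDual_ext fun f ↦ ?_
  rw [expFun_apply, tsum_eq_single 0 fun n hn ↦ by simp [divPow, hn]]
  simp [divPow]

/-- The exponential map from the Lie algebra to the complex points of the group. -/
noncomputable def expPoint (x : lieAlg H) : Points H ℂ := toConv <|
  AlgHom.ofLinearMap (expFun x.1).ofConv (expFun_apply_one x.2) (expFun_mul_apply x.2)

/-- A complex point of the group, as a functional. -/
def Points.toDual (h : Points H ℂ) : ConvDual H := toConv h.ofConv.toLinearMap

@[simp] lemma Points.toDual_apply (h : Points H ℂ) (f : H) : h.toDual f = h f := rfl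

lemma Points.toDual_injective : Function.Injective (Points.toDual (H := H)) := fun _ _ e ↦
  WithConv.ext (AlgHom.ext fun f ↦ congrArg (fun φ : ConvDual H ↦ φ f) e)

@[simp] lemma Points.toDual_mul (h k : Points H ℂ) : (h * k).toDual = h.toDual * k.toDual := rfl

@[simp] lemma Points.toDual_one : (1 : Points H ℂ).toDual = 1 := rfl

@[simp] lemma toDual_expPoint (x : lieAlg H) : (expPoint x).toDual = expFun x.1 := rfl

lemma expPoint_zero : expPoint (0 : lieAlg H) = 1 :=
  Points.toDual_injective expFun_zero

lemma expPoint_add_of_lie_eq_zero {x y : lieAlg H} (h : ⁅x, y⁆ = 0) :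
    expPoint (x + y) = expPoint x * expPoint y := by
  apply Points.toDual_injective
  have h' : ⁅x.1, y.1⁆ = 0 := congrArg Subtype.val h
  rw [Ring.lie_def, sub_eq_zero] at h'
  exact expFun_add_of_commute h'

lemma expPoint_neg (x : lieAlg H) : expPoint (-x) = (expPoint x)⁻¹ := by
  rw [eq_comm, inv_eq_iff_mul_eq_one, ← expPoint_add_of_lie_eq_zero (by simp), add_neg_cancel,
    expPoint_zero]

lemma Points.rightTrans_mul_apply (h : Points H ℂ) (a b : H) :
    rightTrans h.toDual (a * b) = rightTrans h.toDual a * rightTrans h.toDual b := by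
  rw [rightTrans_eq_sum _ ((ℛ ℂ a).mul (ℛ ℂ b)), rightTrans_eq_sum _ (ℛ ℂ a),
    rightTrans_eq_sum _ (ℛ ℂ b)]
  simp only [Coalgebra.Repr.mul_index, Coalgebra.Repr.mul_left, Coalgebra.Repr.mul_right,
    Finset.sum_product, Finset.sum_mul_sum, Points.toDual_apply, map_mul, smul_mul_smul_comm]

lemma Points.leftTrans_mul_apply (h : Points H ℂ) (a b : H) :
    leftTrans h.toDual (a * b) = leftTrans h.toDual a * leftTrans h.toDual b := by
  rw [leftTrans_eq_sum _ ((ℛ ℂ a).mul (ℛ ℂ b)), leftTrans_eq_sum _ (ℛ ℂ a),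
    leftTrans_eq_sum _ (ℛ ℂ b)]
  simp only [Coalgebra.Repr.mul_index, Coalgebra.Repr.mul_left, Coalgebra.Repr.mul_right,
    Finset.sum_product, Finset.sum_mul_sum, Points.toDual_apply, map_mul, smul_mul_smul_comm]

/-- When `φ` is a point and `ψ` its inverse, conjugation becomes precomposition with a
multiplicative map of `H` preserving the counit. -/
lemma mul_mul_apply (φ x ψ : ConvDual H) (f : H) :
    (φ * x * ψ) f = x (leftTrans φ (rightTrans ψ f)) := by
  rw [mul_apply_rightTrans, mul_apply_leftTrans]

@[simp] lemma Points.toDual_mul_toDual_inv (h : Points H ℂ) : h.toDual * h⁻¹.toDual = 1 := by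
  rw [← Points.toDual_mul, mul_inv_cancel, Points.toDual_one]

@[simp] lemma Points.toDual_inv_mul_toDual (h : Points H ℂ) : h⁻¹.toDual * h.toDual = 1 := by
  rw [← Points.toDual_mul, inv_mul_cancel, Points.toDual_one]

/-- The adjoint action of a complex point on functionals preserves the Lie algebra. -/
lemma Points.conj_mem_lieAlg (h : Points H ℂ) {x : ConvDual H} (hx : x ∈ lieAlg H) :
    h.toDual * x * h⁻¹.toDual ∈ lieAlg H := by
  intro a b
  have hε : ∀ c : H, counit (R := ℂ) c =
      counit (R := ℂ) (leftTrans h.toDual (rightTrans h⁻¹.toDual c)) := fun c ↦ by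
    rw [← convDual_one_apply (leftTrans _ _), ← mul_mul_apply, mul_one,
      Points.toDual_mul_toDual_inv, convDual_one_apply]
  rw [hε a, hε b, mul_mul_apply, mul_mul_apply, mul_mul_apply, Points.rightTrans_mul_apply,
    Points.leftTrans_mul_apply, lieAlg_apply_mul hx]

/-- The adjoint action of a complex point on the Lie algebra. -/
noncomputable def Points.adjoint (h : Points H ℂ) : lieAlg H →ₗ⁅ℂ⁆ lieAlg H where
  toFun x := ⟨h.toDual * x.1 * h⁻¹.toDual, h.conj_mem_lieAlg x.2⟩
  map_add' x y := Subtype.ext (by simp [mul_add, add_mul])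
  map_smul' c x := Subtype.ext (by simp)
  map_lie' {x y} := Subtype.ext (by
    have e : ∀ x y : ConvDual H, h.toDual * (x * y) * h⁻¹.toDual =
        h.toDual * x * h⁻¹.toDual * (h.toDual * y * h⁻¹.toDual) := fun x y ↦ by
      simp only [mul_assoc]
      rw [← mul_assoc h⁻¹.toDual, Points.toDual_inv_mul_toDual, one_mul]
    simp only [LieSubalgebra.coe_bracket, Ring.lie_def, mul_sub, sub_mul, e])

lemma Points.coe_adjoint (h : Points H ℂ) (x : lieAlg H) :
    (h.adjoint x : ConvDual H) = h.toDual * x.1 * h⁻¹.toDual := rfl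

lemma Points.conj_pow (h : Points H ℂ) (x : ConvDual H) (n : ℕ) :
    (h.toDual * x * h⁻¹.toDual) ^ n = h.toDual * x ^ n * h⁻¹.toDual := by
  induction n with
  | zero => simp
  | succ n ih =>
    rw [pow_succ, ih, pow_succ]
    simp only [mul_assoc]
    rw [← mul_assoc h⁻¹.toDual, Points.toDual_inv_mul_toDual, one_mul]

lemma Points.adjoint_adjoint_inv (h : Points H ℂ) (x : lieAlg H) :
    h.adjoint (h⁻¹.adjoint x) = x := by
  refine Subtype.ext ?_
  rw [Points.coe_adjoint, Points.coe_adjoint, inv_inv]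
  simp only [mul_assoc, Points.toDual_mul_toDual_inv, mul_one]
  rw [← mul_assoc, Points.toDual_mul_toDual_inv, one_mul]

lemma expPoint_adjoint (h : Points H ℂ) (x : lieAlg H) :
    expPoint (h.adjoint x) = h * expPoint x * h⁻¹ := by
  apply Points.toDual_injective
  rw [Points.toDual_mul, Points.toDual_mul, toDual_expPoint, toDual_expPoint, Points.coe_adjoint]
  refine convDual_ext fun f ↦ ?_
  rw [mul_mul_apply, expFun_apply, expFun_apply]
  exact tsum_congr fun n ↦ by rw [divPow, divPow, Points.conj_pow, mul_mul_apply]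

end Exponential

/-! ### Stability of characteristic ideals under automorphisms. -/

section LieIdeals

variable {R L : Type*} [CommRing R] [LieRing L] [LieAlgebra R L]

/-- The preimage of the radical under the inverse automorphism `e'` embeds in the radical, so it is
a solvable ideal and lies in the radical. -/
lemma radical_le_comap [IsNoetherian R L] {e e' : L →ₗ⁅R⁆ L} (h : ∀ x, e' (e x) = x)
    (h' : ∀ x, e (e' x) = x) :
    LieAlgebra.radical R L ≤ (LieAlgebra.radical R L).comap e := by
  let j : (LieAlgebra.radical R L).comap e' →ₗ⁅R⁆ LieAlgebra.radical R L :=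
    { toFun := fun z ↦ ⟨e' z.1, LieIdeal.mem_comap.1 z.2⟩
      map_add' := fun x y ↦ Subtype.ext (map_add e' x.1 y.1)
      map_smul' := fun c x ↦ Subtype.ext (map_smul e' c x.1)
      map_lie' := fun {x y} ↦ Subtype.ext (LieHom.map_lie e' x.1 y.1) }
  have hj : Function.Injective j := fun x y hxy ↦ Subtype.ext <| by
    rw [← h' x.1, ← h' y.1]
    exact congrArg e (congrArg Subtype.val hxy)
  have hs : LieAlgebra.IsSolvable ((LieAlgebra.radical R L).comap e') :=
    hj.lieAlgebra_isSolvable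
  intro x hx
  rw [LieIdeal.mem_comap]
  refine (LieAlgebra.LieIdeal.solvable_iff_le_radical R L _).1 hs ?_
  rw [LieIdeal.mem_comap, h]
  exact hx

lemma derivedSeriesOfIdeal_le_comap {I : LieIdeal R L} {e : L →ₗ⁅R⁆ L} (h : I ≤ I.comap e)
    (k : ℕ) : LieAlgebra.derivedSeriesOfIdeal R L k I ≤
      (LieAlgebra.derivedSeriesOfIdeal R L k I).comap e := by
  induction k with
  | zero => exact h
  | succ k ih =>
    rw [LieAlgebra.derivedSeriesOfIdeal_succ]
    rw [← LieIdeal.map_le_iff_le_comap] at ih ⊢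
    exact (LieIdeal.map_bracket_le e).trans (LieSubmodule.mono_lie ih ih)

lemma derivedAbelianOfIdeal_le_comap {I : LieIdeal R L} {e : L →ₗ⁅R⁆ L} (h : I ≤ I.comap e) :
    LieAlgebra.derivedAbelianOfIdeal I ≤ (LieAlgebra.derivedAbelianOfIdeal I).comap e := by
  unfold LieAlgebra.derivedAbelianOfIdeal
  split
  · exact bot_le
  · exact derivedSeriesOfIdeal_le_comap h _

end LieIdeals

/-! ### Zariski closures of subgroups, and the radical of the Lie algebra. -/

section Radical

variable {H : Type*} [CommRing H] [HopfAlgebra ℂ H]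

lemma Points.mul_apply_right (h k : Points H ℂ) (f : H) :
    (h * k) f = h (rightTrans k.toDual f) := mul_apply_rightTrans h.toDual k.toDual f

lemma Points.mul_apply_left (h k : Points H ℂ) (f : H) :
    (h * k) f = k (leftTrans h.toDual f) := mul_apply_leftTrans h.toDual k.toDual f

lemma Points.inv_apply (h : Points H ℂ) (f : H) : h⁻¹ f = h (HopfAlgebra.antipode ℂ f) := rfl

lemma Points.ext_apply {h k : Points H ℂ} (e : ∀ f : H, h f = k f) : h = k :=
  WithConv.ext (AlgHom.ext e)

/-- The Zariski closure of a set of complex points. -/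
def zeroSet (S : Set (Points H ℂ)) : Set (Points H ℂ) :=
  {h | ∀ f : H, (∀ s ∈ S, s f = 0) → h f = 0}

lemma subset_zeroSet (S : Set (Points H ℂ)) : S ⊆ zeroSet S := fun s hs _ hf ↦ hf s hs

lemma isClosed_zeroSet (S : Set (Points H ℂ)) :
    @IsClosed _ (zariskiTopology H) (zeroSet S) := by
  let _ := zariskiTopology H
  refine isClosed_induced_iff.2 ⟨PrimeSpectrum.zeroLocus {f | ∀ s ∈ S, s f = 0},
    PrimeSpectrum.isClosed_zeroLocus _, ?_⟩
  ext h
  rfl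

lemma zeroSet_subset_closure (S : Set (Points H ℂ)) :
    zeroSet S ⊆ @closure _ (zariskiTopology H) S := by
  let _ := zariskiTopology H
  intro h hh
  rw [closure_induced, ← PrimeSpectrum.zeroLocus_vanishingIdeal_eq_closure]
  intro f hf
  refine hh f fun s hs ↦ ?_
  exact (PrimeSpectrum.mem_vanishingIdeal _ _).1 hf _ ⟨s, hs, rfl⟩

/-- The Zariski closure of a subgroup of the group of complex points. -/
def zariskiClosure (S : Subgroup (Points H ℂ)) : Subgroup (Points H ℂ) where
  carrier := zeroSet S
  one_mem' := subset_zeroSet _ S.one_mem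
  mul_mem' {h k} hh hk := by
    intro f hf
    rw [Points.mul_apply_right]
    refine hh _ fun s hs ↦ ?_
    rw [← Points.mul_apply_right, Points.mul_apply_left]
    refine hk _ fun t ht ↦ ?_
    rw [← Points.mul_apply_left]
    exact hf _ (S.mul_mem hs ht)
  inv_mem' {h} hh := by
    intro f hf
    rw [Points.inv_apply]
    refine hh _ fun s hs ↦ ?_
    rw [← Points.inv_apply]
    exact hf _ (S.inv_mem hs)

lemma zariskiClosure_normal (S : Subgroup (Points H ℂ)) [hS : S.Normal] :
    (zariskiClosure S).Normal where
  conj_mem h hh k f hf := by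
    rw [Points.mul_apply_right, Points.mul_apply_left]
    refine hh _ fun s hs ↦ ?_
    rw [← Points.mul_apply_left, ← Points.mul_apply_right]
    exact hf _ (hS.conj_mem s hs k)

/-- Commuting with a fixed point is a Zariski-closed condition; it is extended to the closure in one
variable, then in the other. -/
lemma zariskiClosure_commute {S : Subgroup (Points H ℂ)}
    (hS : ∀ s ∈ S, ∀ t ∈ S, s * t = t * s) {h k : Points H ℂ} (hh : h ∈ zariskiClosure S)
    (hk : k ∈ zariskiClosure S) : h * k = k * h := by
  have key : ∀ s : Points H ℂ, (∀ t ∈ S, s * t = t * s) → ∀ k ∈ zariskiClosure S, s * k = k * s := by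
    intro s hs k hk
    refine Points.ext_apply fun f ↦ ?_
    rw [Points.mul_apply_left, Points.mul_apply_right, ← sub_eq_zero, ← map_sub]
    refine hk _ fun t ht ↦ ?_
    rw [map_sub, ← Points.mul_apply_left, ← Points.mul_apply_right, hs t ht, sub_self]
  exact key h (fun t ht ↦ (key t (fun s hs ↦ hS t ht s hs) h hh).symm) k hk

lemma isClosed_zariskiClosure (S : Subgroup (Points H ℂ)) :
    @IsClosed _ (zariskiTopology H) (zariskiClosure S : Set (Points H ℂ)) := isClosed_zeroSet _

lemma isConnected_zariskiClosure {S : Subgroup (Points H ℂ)}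
    (hS : @IsPreconnected _ (zariskiTopology H) (S : Set (Points H ℂ))) :
    @IsConnected _ (zariskiTopology H) (zariskiClosure S : Set (Points H ℂ)) := by
  let _ := zariskiTopology H
  exact ⟨⟨1, (zariskiClosure S).one_mem⟩,
    hS.subset_closure (subset_zeroSet _) (zeroSet_subset_closure _)⟩

/-- The one-parameter group of an element of the Lie algebra is Zariski continuous. -/
lemma continuous_expPoint_smul (x : lieAlg H) :
    @Continuous ℂ _ _ (zariskiTopology H) fun t : ℂ ↦ expPoint (t • x) := by
  let _ := zariskiTopology H
  refine continuous_induced_rng.2 ?_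
  refine PrimeSpectrum.isTopologicalBasis_basic_opens.continuous_iff.2 ?_
  rintro _ ⟨f, rfl⟩
  -- `ℂ` carries its classical topology, so analytic continuity suffices.
  have : IsOpen {t : ℂ | expFun (t • x.1) f ≠ 0} :=
    isOpen_ne.preimage (continuous_expFun_smul x.1 f)
  exact this

/-- The subgroup of exponentials of an abelian ideal. -/
noncomputable def expSubgroup (a : LieIdeal ℂ (lieAlg H)) (ha : ∀ x ∈ a, ∀ y ∈ a, ⁅x, y⁆ = 0) :
    Subgroup (Points H ℂ) where
  carrier := expPoint '' (a : Set (lieAlg H))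
  one_mem' := ⟨0, a.zero_mem, expPoint_zero⟩
  mul_mem' := by
    rintro _ _ ⟨x, hx, rfl⟩ ⟨y, hy, rfl⟩
    exact ⟨x + y, a.add_mem hx hy, expPoint_add_of_lie_eq_zero (ha x hx y hy)⟩
  inv_mem' := by
    rintro _ ⟨x, hx, rfl⟩
    exact ⟨-x, neg_mem hx, expPoint_neg x⟩

/-- Each element is joined to `1` by a one-parameter group, a continuous image of `ℂ`. -/
lemma isPreconnected_expSubgroup (a : LieIdeal ℂ (lieAlg H)) (ha : ∀ x ∈ a, ∀ y ∈ a, ⁅x, y⁆ = 0) :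
    @IsPreconnected _ (zariskiTopology H) (expSubgroup a ha : Set (Points H ℂ)) := by
  let _ := zariskiTopology H
  refine isPreconnected_of_forall 1 ?_
  rintro _ ⟨x, hx, rfl⟩
  refine ⟨Set.range fun t : ℂ ↦ expPoint (t • x), ?_, ⟨0, by simp [expPoint_zero]⟩,
    ⟨1, by simp⟩, isPreconnected_range (continuous_expPoint_smul x)⟩
  rintro _ ⟨t, rfl⟩
  exact ⟨t • x, a.smul_mem t hx, rfl⟩

/-- The derivative of `exp(t x)` at `t = 0` is `x`. -/
lemma eq_zero_of_forall_expPoint_smul {x : lieAlg H} (h : ∀ t : ℂ, expPoint (t • x) = 1) :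
    x = 0 := by
  refine Subtype.ext (convDual_ext fun f ↦ ?_)
  have h1 : (fun t : ℂ ↦ expFun (t • x.1) f) = fun _ ↦ counit (R := ℂ) f := by
    funext t
    exact congrArg (fun p : Points H ℂ ↦ p f) (h t)
  have h2 := hasDerivAt_expFun_smul_zero x.1 f
  rw [h1] at h2
  exact h2.unique (hasDerivAt_const _ _)

/-- If the radical of the group is trivial, so is that of its Lie algebra. -/
theorem hasTrivialRadical_lieAlg [Algebra.FiniteType ℂ H]
    (hrad : ∀ N : Subgroup (Points H ℂ), N.Normal →
      @IsClosed _ (zariskiTopology H) (N : Set (Points H ℂ)) →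
      @IsConnected _ (zariskiTopology H) (N : Set (Points H ℂ)) →
      Group.IsSolvable N → N = ⊥) :
    LieAlgebra.HasTrivialRadical ℂ (lieAlg H) := by
  have := finiteDimensional_lieAlg (H := H)
  set r := LieAlgebra.radical ℂ (lieAlg H) with hr
  -- The last nonzero term of the derived series of the radical: abelian, stable under the adjoint
  -- action, and zero only if the radical is.
  set a := LieAlgebra.derivedAbelianOfIdeal r with ha
  have hstab : ∀ h : Points H ℂ, ∀ x ∈ a, h.adjoint x ∈ a := by
    intro h x hx
    have h1 : r ≤ r.comap h.adjoint := radical_le_comap (e' := h⁻¹.adjoint)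
      (fun x ↦ by simpa using h⁻¹.adjoint_adjoint_inv x) h.adjoint_adjoint_inv
    exact LieIdeal.mem_comap.1 (derivedAbelianOfIdeal_le_comap h1 hx)
  have hab : ∀ x ∈ a, ∀ y ∈ a, ⁅x, y⁆ = 0 := by
    intro x hx y hy
    have := LieAlgebra.abelian_derivedAbelianOfIdeal r
    exact congrArg Subtype.val (LieModule.IsTrivial.trivial (⟨x, hx⟩ : a) (⟨y, hy⟩ : a))
  let S := expSubgroup a hab
  have hSn : S.Normal := ⟨by
    rintro _ ⟨x, hx, rfl⟩ h
    exact ⟨h.adjoint x, hstab h x hx, expPoint_adjoint h x⟩⟩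
  have hSc : ∀ s ∈ S, ∀ t ∈ S, s * t = t * s := by
    rintro _ ⟨x, hx, rfl⟩ _ ⟨y, hy, rfl⟩
    rw [← expPoint_add_of_lie_eq_zero (hab x hx y hy), add_comm,
      expPoint_add_of_lie_eq_zero (hab y hy x hx)]
  have hN := hrad (zariskiClosure S) (zariskiClosure_normal S) (isClosed_zariskiClosure S)
    (isConnected_zariskiClosure (isPreconnected_expSubgroup a hab))
    (by
      let _ : CommGroup (zariskiClosure S) :=
        { mul_comm := fun x y ↦ Subtype.ext (zariskiClosure_commute hSc x.2 y.2) }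
      infer_instance)
  have ha0 : a = ⊥ := by
    rw [eq_bot_iff]
    intro x hx
    rw [LieSubmodule.mem_bot]
    refine eq_zero_of_forall_expPoint_smul fun t ↦ ?_
    have : expPoint (t • x) ∈ zariskiClosure S :=
      subset_zeroSet _ ⟨t • x, a.smul_mem t hx, rfl⟩
    rwa [hN, Subgroup.mem_bot] at this
  exact ⟨(LieAlgebra.abelian_of_solvable_ideal_eq_bot_iff r).1 ha0⟩

end Radical

/-! ### Nilpotency from eigenvalues of `ad`. -/

section Endomorphisms

attribute [local instance] LieRing.ofAssociativeRing

variable {V : Type*} [AddCommGroup V] [Module ℂ V] [FiniteDimensional ℂ V]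

/-- A generalized eigenvector of `ad X` for a nonzero eigenvalue is nilpotent. -/
lemma isNilpotent_of_mem_maxGenEigenspace_ad {X Y : Module.End ℂ V} {c : ℂ} (hc : c ≠ 0)
    (hY : Y ∈ (LieAlgebra.ad ℂ (Module.End ℂ V) X).maxGenEigenspace c) : IsNilpotent Y := by
  have step : ∀ (μ : ℂ) (v : V), v ∈ X.maxGenEigenspace μ → Y v ∈ X.maxGenEigenspace (c + μ) := by
    intro μ v hv
    exact LieModule.lie_mem_maxGenEigenspace_toEnd (R := ℂ) (L := Module.End ℂ V) (M := V)
      (x := X) hY hv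
  have steps : ∀ (k : ℕ) (μ : ℂ) (v : V), v ∈ X.maxGenEigenspace μ →
      (Y ^ k) v ∈ X.maxGenEigenspace (k * c + μ) := by
    intro k
    induction k with
    | zero => intro μ v hv; simpa using hv
    | succ k ih =>
      intro μ v hv
      rw [pow_succ', Module.End.mul_apply]
      have := step _ _ (ih μ v hv)
      rwa [← add_assoc, show c + k * c = ((k + 1 : ℕ) : ℂ) * c by push_cast; ring] at this
  have hfin : {μ : ℂ | X.maxGenEigenspace μ ≠ ⊥}.Finite :=
    WellFoundedGT.finite_ne_bot_of_iSupIndep X.independent_maxGenEigenspace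
  rw [Module.End.isNilpotent_iff_of_finite]
  intro v
  have hv : v ∈ ⨆ μ, X.maxGenEigenspace μ := by
    rw [Module.End.iSup_maxGenEigenspace_eq_top]; trivial
  induction hv using Submodule.iSup_induction' with
  | mem μ v hv =>
    -- `Y` shifts generalized eigenvalues of `X` by `c ≠ 0`. The values `k * c + μ` are distinct and
    -- only finitely many are eigenvalues, so some `Y ^ k` kills `v`.
    have hinj : Function.Injective fun k : ℕ ↦ (k * c + μ : ℂ) := by
      intro k l hkl
      simpa [hc] using hkl
    obtain ⟨k, hk⟩ := (hfin.preimage hinj.injOn).exists_notMem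
    simp only [Set.mem_preimage, Set.mem_ofPred_eq, not_not] at hk
    refine ⟨k, ?_⟩
    have := steps k μ v hv
    rwa [hk, Submodule.mem_bot] at this
  | zero => exact ⟨0, by simp⟩
  | add v w _ _ hv hw =>
    obtain ⟨k, hk⟩ := hv
    obtain ⟨l, hl⟩ := hw
    refine ⟨k + l, ?_⟩
    rw [map_add, Module.End.pow_map_zero_of_le (Nat.le_add_right k l) hk,
      Module.End.pow_map_zero_of_le (Nat.le_add_left l k) hl, add_zero]

end Endomorphisms

/-! ### The Lie algebra is spanned by locally nilpotent elements. -/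

section Nilpotents

attribute [local instance] LieRing.ofAssociativeRing

variable {H : Type*} [CommRing H] [HopfAlgebra ℂ H]

/-- A functional is locally nilpotent if its high powers vanish on every given function. -/
def IsLocNilpotent (y : ConvDual H) : Prop := ∀ f : H, ∃ m : ℕ, ∀ n, m ≤ n → (y ^ n) f = 0

lemma isLocNilpotent_of_forall_orbitRep {y : ConvDual H} (h : ∀ f, IsNilpotent (orbitRep f y)) :
    IsLocNilpotent y := by
  intro f
  obtain ⟨m, hm⟩ := h f
  refine ⟨m, fun n hn ↦ ?_⟩
  have h0 : orbitRep f (y ^ n) = 0 := by rw [map_pow]; exact pow_eq_zero_of_le hn hm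
  have := apply_eq_counit_orbitRep f (y ^ n)
  rw [h0] at this
  simpa using this

/-- Each `orbitRep f` respects commutators, so it carries generalized eigenvectors of `ad x` to
those of `ad (orbitRep f x)`, where the finite-dimensional result applies. -/
lemma isLocNilpotent_of_mem_maxGenEigenspace {x y : lieAlg H} {c : ℂ} (hc : c ≠ 0)
    (hy : y ∈ (LieAlgebra.ad ℂ (lieAlg H) x).maxGenEigenspace c) : IsLocNilpotent y.1 := by
  refine isLocNilpotent_of_forall_orbitRep fun f ↦ ?_
  refine isNilpotent_of_mem_maxGenEigenspace_ad (X := orbitRep f x.1) hc ?_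
  rw [Module.End.mem_maxGenEigenspace] at hy ⊢
  obtain ⟨k, hk⟩ := hy
  refine ⟨k, ?_⟩
  have key : ∀ (k : ℕ) (z : lieAlg H),
      ((LieAlgebra.ad ℂ (Module.End ℂ (orbitSpan f)) (orbitRep f x.1) - c • 1) ^ k)
        (orbitRep f z.1) = orbitRep f (((LieAlgebra.ad ℂ (lieAlg H) x - c • 1) ^ k) z).1 := by
    intro k
    induction k with
    | zero => intro z; rfl
    | succ k ih =>
      intro z
      rw [pow_succ, pow_succ, Module.End.mul_apply, Module.End.mul_apply, ← ih]
      congr 1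
      simp [Ring.lie_def]
  rw [key, hk]
  simp

lemma IsLocNilpotent.adjoint {y : lieAlg H} (hy : IsLocNilpotent y.1) (h : Points H ℂ) :
    IsLocNilpotent (h.adjoint y).1 := by
  intro f
  obtain ⟨m, hm⟩ := hy (leftTrans h.toDual (rightTrans h⁻¹.toDual f))
  refine ⟨m, fun n hn ↦ ?_⟩
  rw [Points.coe_adjoint, Points.conj_pow, mul_mul_apply]
  exact hm n hn

/-- Evaluation at a function, as a functional on the Lie algebra. -/
noncomputable def evalLie : H →ₗ[ℂ] Module.Dual ℂ (lieAlg H) where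
  toFun f :=
    { toFun := fun x ↦ x.1 f
      map_add' := fun _ _ ↦ rfl
      map_smul' := fun _ _ ↦ rfl }
  map_add' f g := LinearMap.ext fun x ↦ map_add x.1.ofConv f g
  map_smul' c f := LinearMap.ext fun x ↦ map_smul x.1.ofConv c f

@[simp] lemma evalLie_apply (f : H) (x : lieAlg H) : evalLie f x = x.1 f := rfl

/-- A form on the dual that kills the range is evaluation at some `x` vanishing on all of `H`, that
is, at `0`. Linear forms on the Lie algebra thus become functions, along which one-parameter groups
can be differentiated. -/
lemma evalLie_surjective [FiniteDimensional ℂ (lieAlg H)] :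
    Function.Surjective (evalLie (H := H)) := by
  rw [← LinearMap.range_eq_top]
  by_contra hne
  obtain ⟨F, hF, hle⟩ := Submodule.exists_le_ker_of_lt_top _ (lt_top_iff_ne_top.2 hne)
  obtain ⟨x, rfl⟩ := (Module.evalEquiv ℂ (lieAlg H)).surjective F
  apply hF
  have hx : x = 0 := Subtype.ext <| convDual_ext fun f ↦ by
    simpa using hle ⟨f, rfl⟩
  rw [hx, map_zero]

/-- The first-order expansion of the adjoint action of a one-parameter group. -/
lemma hasDerivAt_adjoint_expPoint_smul (x y : lieAlg H) (f : H) :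
    HasDerivAt (fun s : ℂ ↦ ((expPoint (s • x)).adjoint y).1 f) (⁅x, y⁆.1 f) 0 := by
  have h0 : (fun s : ℂ ↦ ((expPoint (s • x)).adjoint y).1 f) = fun s : ℂ ↦
      ∑ i ∈ (ℛ ℂ f).index, expFun (s • x.1) (rightTrans y.1 ((ℛ ℂ f).left i)) *
        expFun (s • (-x.1)) ((ℛ ℂ f).right i) := by
    funext s
    rw [Points.coe_adjoint, ← expPoint_neg, (ℛ ℂ f).convMul_apply, ← smul_neg]
    simp only [mul_apply_rightTrans]
    rfl
  have h1 : ⁅x, y⁆.1 f = ∑ i ∈ (ℛ ℂ f).index,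
      (x.1 (rightTrans y.1 ((ℛ ℂ f).left i)) * expFun ((0 : ℂ) • (-x.1)) ((ℛ ℂ f).right i) +
       expFun ((0 : ℂ) • x.1) (rightTrans y.1 ((ℛ ℂ f).left i)) * (-x.1) ((ℛ ℂ f).right i)) := by
    have e : ⁅x, y⁆.1 = (x.1 * y.1) * 1 + (1 * y.1) * (-x.1) := by
      rw [LieSubalgebra.coe_bracket, Ring.lie_def, mul_one, one_mul]
      exact (sub_eq_add_neg _ _).trans (congrArg _ (mul_neg y.1 x.1).symm)
    rw [e, ofConv_add, LinearMap.add_apply, (ℛ ℂ f).convMul_apply, (ℛ ℂ f).convMul_apply,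
      Finset.sum_add_distrib, zero_smul, zero_smul, expFun_zero]
    simp only [mul_apply_rightTrans]
  rw [h0, h1]
  exact HasDerivAt.fun_sum fun i _ ↦
    (hasDerivAt_expFun_smul_zero _ _).mul (hasDerivAt_expFun_smul_zero _ _)

variable (H) in
/-- The span of the locally nilpotent elements of the Lie algebra. -/
noncomputable def nilSpan : Submodule ℂ (lieAlg H) := Submodule.span ℂ {y | IsLocNilpotent y.1}

lemma adjoint_mem_nilSpan (h : Points H ℂ) {y : lieAlg H} (hy : y ∈ nilSpan H) :
    h.adjoint y ∈ nilSpan H := by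
  have : nilSpan H ≤ (nilSpan H).comap (h.adjoint : lieAlg H →ₗ[ℂ] lieAlg H) :=
    Submodule.span_le.2 fun y hy ↦ Submodule.subset_span (IsLocNilpotent.adjoint hy h)
  exact this hy

/-- The span is stable under `Ad(exp(s x))`. A linear form vanishing on it is constant along this
curve, so it also kills the derivative `⁅x, y⁆` at `s = 0`. -/
lemma lie_mem_nilSpan [FiniteDimensional ℂ (lieAlg H)] (x : lieAlg H) {y : lieAlg H}
    (hy : y ∈ nilSpan H) : ⁅x, y⁆ ∈ nilSpan H := by
  by_contra hn
  obtain ⟨l, hl, hle⟩ := Submodule.exists_le_ker_of_notMem hn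
  obtain ⟨f, rfl⟩ := evalLie_surjective l
  have h1 : (fun s : ℂ ↦ ((expPoint (s • x)).adjoint y).1 f) = fun _ ↦ 0 :=
    funext fun s ↦ hle (adjoint_mem_nilSpan _ hy)
  have h2 := hasDerivAt_adjoint_expPoint_smul x y f
  rw [h1] at h2
  exact hl (h2.unique (hasDerivAt_const _ _))

/-- Split `y` into generalized eigenvectors of `ad x`: those with nonzero eigenvalue are locally
nilpotent, and the remaining part is killed by a power. -/
lemma exists_ad_pow_mem_nilSpan [FiniteDimensional ℂ (lieAlg H)] (x y : lieAlg H) :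
    ∃ k : ℕ, ((LieAlgebra.ad ℂ (lieAlg H) x) ^ k) y ∈ nilSpan H := by
  have hstab : ∀ (j : ℕ) (z : lieAlg H), z ∈ nilSpan H →
      ((LieAlgebra.ad ℂ (lieAlg H) x) ^ j) z ∈ nilSpan H := by
    intro j
    induction j with
    | zero => intro z hz; exact hz
    | succ j ih =>
      intro z hz
      rw [pow_succ', Module.End.mul_apply]
      exact lie_mem_nilSpan x (ih z hz)
  have hy : y ∈ ⨆ μ, (LieAlgebra.ad ℂ (lieAlg H) x).maxGenEigenspace μ := by
    rw [Module.End.iSup_maxGenEigenspace_eq_top]; trivial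
  induction hy using Submodule.iSup_induction' with
  | mem μ y hy =>
    by_cases hμ : μ = 0
    · subst hμ
      rw [Module.End.mem_maxGenEigenspace] at hy
      obtain ⟨k, hk⟩ := hy
      refine ⟨k, ?_⟩
      rw [zero_smul, sub_zero] at hk
      rw [hk]
      exact zero_mem _
    · exact ⟨0, Submodule.subset_span (isLocNilpotent_of_mem_maxGenEigenspace hμ hy)⟩
  | zero => exact ⟨0, zero_mem _⟩
  | add y z _ _ hy hz =>
    obtain ⟨k, hk⟩ := hy
    obtain ⟨l, hl⟩ := hz
    refine ⟨k + l, ?_⟩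
    rw [map_add]
    refine add_mem ?_ ?_
    · rw [add_comm k l, pow_add, Module.End.mul_apply]
      exact hstab l _ hk
    · rw [pow_add, Module.End.mul_apply]
      exact hstab k _ hl

/-- If the Lie algebra has trivial radical, it is spanned by its locally nilpotent elements. -/
theorem nilSpan_eq_top [FiniteDimensional ℂ (lieAlg H)]
    [LieAlgebra.HasTrivialRadical ℂ (lieAlg H)] : nilSpan H = ⊤ := by
  let I : LieIdeal ℂ (lieAlg H) :=
    { nilSpan H with lie_mem := fun {x y} hy ↦ lie_mem_nilSpan x hy }
  -- Trivial radical makes the Lie algebra semisimple, so ideals have complementary ideals.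
  obtain ⟨K, hK⟩ := exists_isCompl I
  -- Engel's theorem: a high power of `ad x` sends `y ∈ K` into both `K` and the span, which meet in
  -- zero.
  have hnil : LieRing.IsNilpotent K := by
    rw [LieAlgebra.isNilpotent_iff_forall (R := ℂ)]
    intro x
    rw [Module.End.isNilpotent_iff_of_finite]
    intro y
    obtain ⟨k, hk⟩ := exists_ad_pow_mem_nilSpan x.1 y.1
    refine ⟨k, ?_⟩
    have e : ∀ k : ℕ, (((LieAlgebra.ad ℂ K x) ^ k) y : lieAlg H) =
        ((LieAlgebra.ad ℂ (lieAlg H) x.1) ^ k) y.1 := by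
      intro k
      induction k with
      | zero => rfl
      | succ k ih =>
        rw [pow_succ', pow_succ', Module.End.mul_apply, Module.End.mul_apply, ← ih]
        rfl
    have hmem : (((LieAlgebra.ad ℂ K x) ^ k) y : lieAlg H) ∈ I ⊓ K :=
      ⟨(e k ▸ hk : _ ∈ nilSpan H), Subtype.prop _⟩
    rw [hK.inf_eq_bot, LieSubmodule.mem_bot] at hmem
    exact Subtype.ext hmem
  have hsol : LieAlgebra.IsSolvable K := inferInstance
  have hK0 : K = ⊥ := LieAlgebra.HasTrivialRadical.eq_bot_of_isSolvable K
  have hI : I = ⊤ := by simpa [hK0] using hK.sup_eq_top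
  exact congrArg LieSubmodule.toSubmodule hI

end Nilpotents

/-! ### Polynomial one-parameter groups with values in any algebra. -/

section OneParameter

variable {H : Type*} [CommRing H] [HopfAlgebra ℂ H]

/-- The polynomial `∑ yⁿ(f) / n! tⁿ` attached to a locally nilpotent functional. -/
noncomputable def expPoly {y : ConvDual H} (hy : IsLocNilpotent y) (f : H) : Polynomial ℂ :=
  ∑ n ∈ Finset.range (hy f).choose, Polynomial.monomial n (divPow y n f)

lemma coeff_expPoly {y : ConvDual H} (hy : IsLocNilpotent y) (f : H) (n : ℕ) :
    (expPoly hy f).coeff n = divPow y n f := by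
  simp only [expPoly, Polynomial.finsetSum_coeff, Polynomial.coeff_monomial,
    Finset.sum_ite_eq', Finset.mem_range]
  split_ifs with h
  · rfl
  · simp [divPow, (hy f).choose_spec n (not_lt.1 h)]

variable (H) in
/-- The locally nilpotent elements of the Lie algebra. -/
abbrev NilElement : Type _ := {y : lieAlg H // IsLocNilpotent y.1}

/-- The exponential of a locally nilpotent element, as a morphism from the affine line. -/
noncomputable def expPolyHom (y : NilElement H) : H →ₐ[ℂ] Polynomial ℂ :=
  AlgHom.ofLinearMap
    { toFun := expPoly y.2
      map_add' := fun f g ↦ by ext n; simp [coeff_expPoly, divPow_add_apply]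
      map_smul' := fun c f ↦ by ext n; simp [coeff_expPoly, divPow_apply_smul] }
    (by ext n; simp [coeff_expPoly, divPow_apply_one y.1.2, Polynomial.coeff_one])
    (fun f g ↦ by ext n; simp [coeff_expPoly, Polynomial.coeff_mul, divPow_mul y.1.2])

lemma coeff_expPolyHom (y : NilElement H) (f : H) (n : ℕ) :
    (expPolyHom y f).coeff n = divPow y.1.1 n f := coeff_expPoly y.2 f n

variable {B B' : Type*} [CommRing B] [Algebra ℂ B] [CommRing B'] [Algebra ℂ B']

/-- The point `exp(s y)` with values in a `ℂ`-algebra. -/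
noncomputable def nilExp (y : NilElement H) (s : B) : Points H B :=
  toConv ((Polynomial.aeval s).comp (expPolyHom y))

lemma nilExp_apply (y : NilElement H) (s : B) (f : H) :
    nilExp y s f = Polynomial.aeval s (expPolyHom y f) := rfl

lemma Points.map_mul (φ : B →ₐ[ℂ] B') (γ δ : Points H B) :
    Points.map H φ (γ * δ) = Points.map H φ γ * Points.map H φ δ := by
  rw [Points.map, AlgHom.comp_convMul_distrib]
  rfl

lemma Points.map_one (φ : B →ₐ[ℂ] B') : Points.map H φ (1 : Points H B) = 1 :=
  WithConv.ext (AlgHom.ext fun _ ↦ φ.commutes _)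

/-- The map on points induced by a homomorphism of algebras, as a monoid homomorphism. -/
def Points.mapHom (φ : B →ₐ[ℂ] B') : Points H B →* Points H B' where
  toFun := Points.map H φ
  map_one' := Points.map_one φ
  map_mul' := Points.map_mul φ

lemma map_nilExp (φ : B →ₐ[ℂ] B') (y : NilElement H) (s : B) :
    Points.map H φ (nilExp y s) = nilExp y (φ s) :=
  WithConv.ext (AlgHom.ext fun _ ↦ (Polynomial.aeval_algHom_apply φ s _).symm)

lemma nilExp_zero (y : NilElement H) : nilExp y (0 : B) = 1 :=
  WithConv.ext <| AlgHom.ext fun f ↦ by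
    change Polynomial.aeval (0 : B) (expPolyHom y f) = algebraMap ℂ B (counit (R := ℂ) f)
    rw [Polynomial.aeval_def, Polynomial.eval₂_at_zero, coeff_expPolyHom, divPow_zero]

/-- The ordered product `exp(s₁ y₁) ⋯ exp(s_N y_N)`. -/
noncomputable def nilExpProd {N : ℕ} (y : Fin N → NilElement H) (s : Fin N → B) : Points H B :=
  (List.ofFn fun i ↦ nilExp (y i) (s i)).prod

lemma map_nilExpProd (φ : B →ₐ[ℂ] B') {N : ℕ} (y : Fin N → NilElement H) (s : Fin N → B) :
    Points.map H φ (nilExpProd y s) = nilExpProd y fun i ↦ φ (s i) := by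
  change Points.mapHom φ _ = _
  rw [nilExpProd, map_list_prod, List.map_ofFn, nilExpProd]
  congr 2
  funext i
  exact map_nilExp φ (y i) (s i)

lemma prod_ofFn_mulSingle {M : Type*} [Monoid M] : ∀ {N : ℕ} (i : Fin N) (a : M),
    (List.ofFn fun j ↦ if j = i then a else 1).prod = a
  | N + 1, i, a => by
    rw [List.ofFn_succ, List.prod_cons]
    refine Fin.cases ?_ (fun i ↦ ?_) i
    · simp [Fin.succ_ne_zero]
    · simpa [(Fin.succ_ne_zero i).symm] using prod_ofFn_mulSingle i a

lemma nilExpProd_single {N : ℕ} (y : Fin N → NilElement H) (i : Fin N) (t : B) :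
    nilExpProd y (fun j ↦ if j = i then t else 0) = nilExp (y i) t := by
  rw [nilExpProd]
  conv_rhs => rw [← prod_ofFn_mulSingle i (nilExp (y i) t)]
  congr 2
  funext j
  split_ifs with h
  · rw [h]
  · exact nilExp_zero _

lemma nilExpProd_zero {N : ℕ} (y : Fin N → NilElement H) :
    nilExpProd y (fun _ ↦ (0 : B)) = 1 := by
  rw [nilExpProd]
  simp [nilExp_zero]

end OneParameter

/-! ### First-order expansion of the product of exponentials. -/

section LinearTerms

open MvPolynomial

lemma coeff_zero_eq_aeval_zero {σ : Type*} (P : MvPolynomial σ ℂ) :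
    P.coeff 0 = aeval (fun _ ↦ (0 : ℂ)) P := by
  rw [← constantCoeff_eq, ← Pi.zero_def, aeval_zero]
  rfl

/-- Restriction to the `i`-th coordinate axis, where the product of exponentials collapses to a
single factor. -/
lemma coeff_single_eq_coeff_aeval {σ : Type*} [DecidableEq σ] (i : σ) (P : MvPolynomial σ ℂ) :
    P.coeff (Finsupp.single i 1) =
      (aeval (fun j ↦ if j = i then (Polynomial.X : Polynomial ℂ) else 0) P).coeff 1 := by
  have h0 : ∀ P : MvPolynomial σ ℂ,
      (aeval (fun j ↦ if j = i then (Polynomial.X : Polynomial ℂ) else 0) P).coeff 0 =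
        P.coeff 0 := by
    intro P
    rw [coeff_zero_eq_aeval_zero, Polynomial.coeff_zero_eq_aeval_zero, ← AlgHom.comp_apply]
    congr 1
    ext j
    simp only [AlgHom.comp_apply, aeval_X]
    split_ifs <;> simp
  induction P using MvPolynomial.induction_on with
  | C a => simp [coeff_C, algHom_C, eq_comm]
  | add P Q hP hQ => rw [coeff_add, map_add, Polynomial.coeff_add, hP, hQ]
  | mul_X P j _ =>
    rw [map_mul, aeval_X, coeff_mul_X']
    by_cases hj : j = i
    · subst hj
      simp [h0, Polynomial.coeff_mul_X (n := 0)]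
    · simp [hj]

variable {H : Type*} [CommRing H] [HopfAlgebra ℂ H]

/-- The first-order expansion of the parametrization `exp(X₁ y₁) ⋯ exp(X_N y_N)`. -/
lemma nilExpProd_X_sub_mem {N : ℕ} (y : Fin N → NilElement H) {u : H}
    (hu : counit (R := ℂ) u = 0) :
    nilExpProd y (fun i ↦ (X i : MvPolynomial (Fin N) ℂ)) u - ∑ i, (y i).1.1 u • X i ∈
      idealOfVars (Fin N) ℂ ^ 2 := by
  classical
  have hmap : ∀ {B : Type} [CommRing B] [Algebra ℂ B] (s : Fin N → B),
      aeval s (nilExpProd y (fun i ↦ (X i : MvPolynomial (Fin N) ℂ)) u) = nilExpProd y s u := by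
    intro B _ _ s
    have := map_nilExpProd (aeval s) y (fun i ↦ (X i : MvPolynomial (Fin N) ℂ))
    simp only [aeval_X] at this
    rw [← this]
    rfl
  rw [mem_pow_idealOfVars_iff']
  intro m hm
  have hm' : m = 0 ∨ ∃ i, m = Finsupp.single i 1 := by
    by_cases h0 : m = 0
    · exact Or.inl h0
    obtain ⟨i, hi⟩ := Finsupp.ne_iff.1 h0
    obtain ⟨m', rfl⟩ := le_iff_exists_add.1
      (Finsupp.single_le_iff.2 (Nat.one_le_iff_ne_zero.2 hi) : Finsupp.single i 1 ≤ m)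
    refine Or.inr ⟨i, ?_⟩
    rw [map_add, Finsupp.degree_single] at hm
    rw [(Finsupp.degree_eq_zero_iff m').1 (by omega), add_zero]
  rcases hm' with rfl | ⟨i, rfl⟩
  · rw [coeff_sub, coeff_zero_eq_aeval_zero, hmap, nilExpProd_zero]
    simp [coeff_sum, hu]
  · rw [coeff_sub, coeff_single_eq_coeff_aeval, hmap, nilExpProd_single, nilExp_apply]
    simp [coeff_sum, coeff_X, coeff_expPolyHom, divPow_one, Finsupp.single_left_inj]

end LinearTerms

/-! ### The parametrization is injective on functions near the identity. -/

section LocalParameters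

open MvPolynomial

variable {H : Type*} [CommRing H] [HopfAlgebra ℂ H]

variable (H) in
/-- The ideal of functions vanishing at the identity. -/
noncomputable abbrev augIdeal : Ideal H := RingHom.ker (Bialgebra.counitAlgHom ℂ H)

lemma mem_augIdeal {f : H} : f ∈ augIdeal H ↔ counit (R := ℂ) f = 0 := Iff.rfl

lemma sub_counit_mem_augIdeal (f : H) : f - algebraMap ℂ H (counit f) ∈ augIdeal H := by
  simp

lemma map_mem_ideal_pow {R S : Type*} [CommRing R] [CommRing S] [Algebra ℂ R] [Algebra ℂ S]
    {φ : R →ₐ[ℂ] S} {I : Ideal R} {J : Ideal S} (h : ∀ x ∈ I, φ x ∈ J) (k : ℕ) {x : R}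
    (hx : x ∈ I ^ k) : φ x ∈ J ^ k := by
  have h2 := Ideal.mem_map_of_mem φ hx
  rw [Ideal.map_pow] at h2
  exact Ideal.pow_right_mono (Ideal.map_le_iff_le_comap.2 h) k h2

lemma aeval_mem_augIdeal_pow {σ : Type*} {u : σ → H} (hu : ∀ i, u i ∈ augIdeal H) (k : ℕ)
    {P : MvPolynomial σ ℂ} (hP : P ∈ idealOfVars σ ℂ ^ k) : aeval u P ∈ augIdeal H ^ k := by
  refine map_mem_ideal_pow ?_ k hP
  change idealOfVars σ ℂ ≤ (augIdeal H).comap (aeval u)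
  rw [idealOfVars, Ideal.span_le]
  rintro _ ⟨i, rfl⟩
  simpa using hu i

/-- The Lie algebra is dual to the cotangent space at the identity. -/
lemma mem_augIdeal_sq_of_forall_lieAlg {v : H} (hv : v ∈ augIdeal H)
    (h : ∀ x ∈ lieAlg H, x v = 0) : v ∈ augIdeal H ^ 2 := by
  by_contra hn
  -- A functional killing both the squared ideal and the constants is a point derivation; one
  -- separating `v` from `W` contradicts the hypothesis.
  let W : Submodule ℂ H := (augIdeal H ^ 2).restrictScalars ℂ ⊔ Submodule.span ℂ {1}
  have hW : v ∉ W := by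
    intro hW
    obtain ⟨w, hw, z, hz, rfl⟩ := Submodule.mem_sup.1 hW
    obtain ⟨c, rfl⟩ := Submodule.mem_span_singleton.1 hz
    have hw' : w ∈ augIdeal H := Ideal.pow_le_self two_ne_zero hw
    rw [mem_augIdeal] at hv hw'
    rw [map_add, hw', map_smul, Bialgebra.counit_one] at hv
    have hc : c = 0 := by simpa using hv
    exact hn (by simpa [hc] using hw)
  obtain ⟨l, hl, hle⟩ := Submodule.exists_le_ker_of_notMem hW
  refine hl (h (toConv l) fun a b ↦ ?_)
  have h1 : l 1 = 0 := hle (Submodule.mem_sup_right (Submodule.mem_span_singleton_self 1))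
  have h2 : l ((a - algebraMap ℂ H (counit a)) * (b - algebraMap ℂ H (counit b))) = 0 :=
    hle (Submodule.mem_sup_left (by
      change _ ∈ augIdeal H ^ 2
      rw [sq]
      exact Ideal.mul_mem_mul (sub_counit_mem_augIdeal a) (sub_counit_mem_augIdeal b)))
  have e : (a - algebraMap ℂ H (counit a)) * (b - algebraMap ℂ H (counit b)) =
      a * b - (counit a : ℂ) • b - (counit b : ℂ) • a + (counit a * counit b : ℂ) • (1 : H) := by
    simp only [Algebra.smul_def, map_mul]
    ring
  rw [e] at h2
  simp only [map_add, map_sub, map_smul, h1, smul_eq_mul] at h2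
  change l (a * b) = counit a * l b + l a * counit b
  linear_combination h2

variable {N : ℕ}

lemma exists_dual_functions [FiniteDimensional ℂ (lieAlg H)]
    (b : Module.Basis (Fin N) ℂ (lieAlg H)) :
    ∃ u : Fin N → H, (∀ i, u i ∈ augIdeal H) ∧ ∀ i j, (b i).1 (u j) = if i = j then 1 else 0 := by
  choose f hf using fun j ↦ evalLie_surjective (b.coord j)
  refine ⟨fun j ↦ f j - algebraMap ℂ H (counit (f j)), fun j ↦ sub_counit_mem_augIdeal _,
    fun i j ↦ ?_⟩
  have h1 : (b i).1 (algebraMap ℂ H (counit (f j))) = 0 := by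
    rw [Algebra.algebraMap_eq_smul_one, map_smul, lieAlg_apply_one (b i).2, smul_zero]
  rw [map_sub, h1, sub_zero, ← evalLie_apply, hf]
  simp [Finsupp.single_apply]

lemma sub_sum_mem_augIdeal_sq (b : Module.Basis (Fin N) ℂ (lieAlg H)) {u : Fin N → H}
    (hu : ∀ i, u i ∈ augIdeal H) (hbu : ∀ i j, (b i).1 (u j) = if i = j then 1 else 0)
    {v : H} (hv : v ∈ augIdeal H) :
    v - ∑ i, (b i).1 v • u i ∈ augIdeal H ^ 2 := by
  refine mem_augIdeal_sq_of_forall_lieAlg ?_ fun x hx ↦ ?_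
  · refine sub_mem hv (sum_mem fun i _ ↦ ?_)
    rw [Algebra.smul_def]
    exact Ideal.mul_mem_left _ _ (hu i)
  · have hle : (⊤ : Submodule ℂ (lieAlg H)) ≤
        LinearMap.ker (evalLie (v - ∑ i, (b i).1 v • u i)) := by
      rw [← b.span_eq, Submodule.span_le]
      rintro _ ⟨i, rfl⟩
      simp [hbu]
    exact hle (Submodule.mem_top : (⟨x, hx⟩ : lieAlg H) ∈ _)

/-- The `u i` span the cotangent space, so their monomials of degree `k` span the `k`-th graded
piece. -/
lemma exists_aeval_sub_mem_augIdeal_pow (b : Module.Basis (Fin N) ℂ (lieAlg H)) {u : Fin N → H}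
    (hu : ∀ i, u i ∈ augIdeal H) (hbu : ∀ i j, (b i).1 (u j) = if i = j then 1 else 0)
    (k : ℕ) {f : H} (hf : f ∈ augIdeal H ^ k) :
    ∃ P ∈ idealOfVars (Fin N) ℂ ^ k, f - aeval u P ∈ augIdeal H ^ (k + 1) := by
  induction k generalizing f with
  | zero =>
    refine ⟨C (counit f), by simp, ?_⟩
    rw [zero_add, pow_one, algHom_C]
    exact sub_counit_mem_augIdeal f
  | succ k ih =>
    rw [pow_succ] at hf
    induction hf using Submodule.mul_induction_on' with
    | mem_mul_mem a ha c hc =>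
      obtain ⟨P, hP, hPa⟩ := ih ha
      set Q : MvPolynomial (Fin N) ℂ := ∑ i, (b i).1 c • X i with hQ
      have hQm : Q ∈ idealOfVars (Fin N) ℂ := sum_mem fun i _ ↦ by
        rw [Algebra.smul_def]
        exact Ideal.mul_mem_left _ _ (Ideal.subset_span ⟨i, rfl⟩)
      have hQc : c - aeval u Q ∈ augIdeal H ^ 2 := by
        simpa [hQ, map_sum] using sub_sum_mem_augIdeal_sq b hu hbu hc
      refine ⟨P * Q, by rw [pow_succ]; exact Ideal.mul_mem_mul hP hQm, ?_⟩
      have e : a * c - aeval u (P * Q) = (a - aeval u P) * c + aeval u P * (c - aeval u Q) := by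
        rw [map_mul]; ring
      rw [e]
      refine add_mem ?_ ?_
      · rw [pow_succ]
        exact Ideal.mul_mem_mul hPa hc
      · rw [add_assoc, pow_add]
        exact Ideal.mul_mem_mul (aeval_mem_augIdeal_pow hu k hP) hQc
    | add f _ g _ hf hg =>
      obtain ⟨P, hP, hPf⟩ := hf
      obtain ⟨Q, hQ, hQg⟩ := hg
      refine ⟨P + Q, add_mem hP hQ, ?_⟩
      rw [map_add, add_sub_add_comm]
      exact add_mem hPf hQg

/-- An endomorphism of the polynomial ring that is the identity to first order acts as the identity
on the associated graded ring of the ideal of variables. -/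
lemma algHom_sub_self_mem_pow {σ : Type*} {θ : MvPolynomial σ ℂ →ₐ[ℂ] MvPolynomial σ ℂ}
    (hθ : ∀ i, θ (X i) - X i ∈ idealOfVars σ ℂ ^ 2) (k : ℕ) {P : MvPolynomial σ ℂ}
    (hP : P ∈ idealOfVars σ ℂ ^ k) : θ P - P ∈ idealOfVars σ ℂ ^ (k + 1) := by
  have h0 : ∀ P : MvPolynomial σ ℂ, θ P - P ∈ idealOfVars σ ℂ := by
    intro P
    induction P using MvPolynomial.induction_on with
    | C a => simp [algHom_C]
    | add P Q hP hQ => rw [map_add, add_sub_add_comm]; exact add_mem hP hQ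
    | mul_X P i _ =>
      have e : θ (P * X i) - P * X i = θ P * (θ (X i) - X i) + (θ P - P) * X i := by
        rw [map_mul]; ring
      rw [e]
      exact add_mem (Ideal.mul_mem_left _ _ (Ideal.pow_le_self two_ne_zero (hθ i)))
        (Ideal.mul_mem_left _ _ (Ideal.subset_span ⟨i, rfl⟩))
  have h1 : ∀ P ∈ idealOfVars σ ℂ, θ P - P ∈ idealOfVars σ ℂ ^ 2 := by
    intro P hP
    induction hP using Submodule.span_induction with
    | mem _ h => obtain ⟨i, rfl⟩ := h; exact hθ i
    | zero => simp
    | add P Q _ _ hP hQ => rw [map_add, add_sub_add_comm]; exact add_mem hP hQ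
    | smul a P hPm hP =>
      have e : θ (a • P) - a • P = θ a * (θ P - P) + (θ a - a) * P := by
        rw [smul_eq_mul, map_mul]; ring
      rw [e]
      refine add_mem (Ideal.mul_mem_left _ _ hP) ?_
      rw [sq]
      exact Ideal.mul_mem_mul (h0 a) hPm
  induction k generalizing P with
  | zero => simpa using h0 P
  | succ k ih =>
    rw [pow_succ] at hP
    induction hP using Submodule.mul_induction_on' with
    | mem_mul_mem P hP Q hQ =>
      have e : θ (P * Q) - P * Q = θ P * (θ Q - Q) + (θ P - P) * Q := by
        rw [map_mul]; ring
      rw [e]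
      refine add_mem ?_ ?_
      · rw [add_assoc, pow_add]
        refine Ideal.mul_mem_mul ?_ (h1 Q hQ)
        rw [← sub_add_cancel (θ P) P]
        exact add_mem (Ideal.pow_le_pow_right (Nat.le_succ k) (ih hP)) hP
      · rw [pow_succ]
        exact Ideal.mul_mem_mul (ih hP) hQ
    | add f _ g _ hf hg => rw [map_add, add_sub_add_comm]; exact add_mem hf hg

/-- A function killed by the parametrization `exp(X₁ y₁) ⋯ exp(X_N y_N)` attached to a basis of the
Lie algebra vanishes to infinite order at the identity. -/
lemma mem_augIdeal_pow_of_nilExpProd_eq_zero [FiniteDimensional ℂ (lieAlg H)]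
    (b : Module.Basis (Fin N) ℂ (lieAlg H)) (y : Fin N → NilElement H) (hy : ∀ i, (y i).1 = b i)
    {f : H} (hf : nilExpProd y (fun i ↦ (X i : MvPolynomial (Fin N) ℂ)) f = 0) (k : ℕ) :
    f ∈ augIdeal H ^ k := by
  obtain ⟨u, hu, hbu⟩ := exists_dual_functions b
  set φ : H →ₐ[ℂ] MvPolynomial (Fin N) ℂ := (nilExpProd y (fun i ↦ X i)).ofConv with hφ
  have hlin : ∀ v ∈ augIdeal H, φ v - ∑ i, (b i).1 v • X i ∈ idealOfVars (Fin N) ℂ ^ 2 := by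
    intro v hv
    simpa only [hy] using nilExpProd_X_sub_mem y hv
  have hφm : ∀ v ∈ augIdeal H, φ v ∈ idealOfVars (Fin N) ℂ := by
    intro v hv
    rw [← sub_add_cancel (φ v) (∑ i, (b i).1 v • X i)]
    refine add_mem (Ideal.pow_le_self two_ne_zero (hlin v hv)) (sum_mem fun i _ ↦ ?_)
    rw [Algebra.smul_def]
    exact Ideal.mul_mem_left _ _ (Ideal.subset_span ⟨i, rfl⟩)
  have hθ : ∀ i, (φ.comp (aeval u)) (X i) - X i ∈ idealOfVars (Fin N) ℂ ^ 2 := by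
    intro j
    have := hlin (u j) (hu j)
    simpa [hbu] using this
  induction k with
  | zero => simp
  | succ k ih =>
    obtain ⟨P, hP, hPf⟩ := exists_aeval_sub_mem_augIdeal_pow b hu hbu k ih
    have h1 := map_mem_ideal_pow hφm _ hPf
    rw [map_sub, show φ f = 0 from hf, zero_sub] at h1
    have h2 := algHom_sub_self_mem_pow hθ k hP
    -- As `φ f = 0`, the image under `φ` of `aeval u P` has order at least `k + 1`; it also agrees
    -- with `P` to that order. So the leading part of `f` vanishes.
    have hP' : P ∈ idealOfVars (Fin N) ℂ ^ (k + 1) := by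
      have := neg_mem (add_mem h1 h2)
      rw [AlgHom.comp_apply] at this
      simpa using this
    have := add_mem hPf (aeval_mem_augIdeal_pow hu _ hP')
    rwa [sub_add_cancel] at this

/-- The functions killed by the parametrization vanish in a neighbourhood of the identity. -/
lemma exists_mul_eq_zero_of_nilExpProd_eq_zero [Algebra.FiniteType ℂ H]
    (b : Module.Basis (Fin N) ℂ (lieAlg H)) (y : Fin N → NilElement H) (hy : ∀ i, (y i).1 = b i) :
    ∃ r : H, counit (R := ℂ) r = 1 ∧
      ∀ f, nilExpProd y (fun i ↦ (X i : MvPolynomial (Fin N) ℂ)) f = 0 → r * f = 0 := by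
  have := finiteDimensional_lieAlg (H := H)
  have : IsNoetherianRing H := Algebra.FiniteType.isNoetherianRing ℂ H
  let K : Ideal H := RingHom.ker (nilExpProd y (fun i ↦ (X i : MvPolynomial (Fin N) ℂ))).ofConv
  -- Krull's intersection theorem: `f`, lying in all powers of the ideal, equals `r • f` for some
  -- `r` in it. Nakayama then gives one multiplier killing all of `K`.
  have hK : K ≤ augIdeal H • K := by
    intro f hf
    have h1 : f ∈ (⨅ i : ℕ, augIdeal H ^ i • ⊤ : Submodule H H) := by
      rw [Submodule.mem_iInf]
      intro k
      simpa using mem_augIdeal_pow_of_nilExpProd_eq_zero b y hy hf k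
    obtain ⟨r, hr⟩ := (Ideal.mem_iInf_smul_pow_eq_bot_iff _ _).1 h1
    rw [← hr]
    exact Submodule.smul_mem_smul r.2 hf
  obtain ⟨r, hr, hrK⟩ := Submodule.exists_sub_one_mem_and_smul_eq_zero_of_fg_of_le_smul
    (augIdeal H) K (IsNoetherian.noetherian K) hK
  refine ⟨r, ?_, fun f hf ↦ hrK f hf⟩
  rw [mem_augIdeal, map_sub, Bialgebra.counit_one, sub_eq_zero] at hr
  exact hr

end LocalParameters

/-! ### Nullstellensatz and Chevalley's theorem on complex points. -/

section ComplexPoints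

variable {R : Type*} [CommRing R] [Algebra ℂ R]

/-- Over the complex numbers, every closed point of an affine scheme of finite type is rational. -/
lemma exists_algHom_ker_eq [Algebra.FiniteType ℂ R] (M : Ideal R) [hM : M.IsMaximal] :
    ∃ h : R →ₐ[ℂ] ℂ, RingHom.ker h = M := by
  let _ : Field (R ⧸ M) := Ideal.Quotient.field M
  have : Module.Finite ℂ (R ⧸ M) := finite_of_finite_type_of_isJacobsonRing ℂ (R ⧸ M)
  let e : ℂ ≃ₐ[ℂ] (R ⧸ M) := AlgEquiv.ofBijective (Algebra.ofId ℂ (R ⧸ M))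
    (IsAlgClosed.algebraMap_bijective_of_isIntegral)
  refine ⟨(e.symm : (R ⧸ M) →ₐ[ℂ] ℂ).comp (Ideal.Quotient.mkₐ ℂ M), ?_⟩
  ext f
  rw [RingHom.mem_ker, AlgHom.comp_apply]
  simp [Ideal.Quotient.eq_zero_iff_mem]

lemma algHom_eq_of_ker_le {h k : R →ₐ[ℂ] ℂ} (e : RingHom.ker h ≤ RingHom.ker k) : h = k := by
  ext f
  have h1 : f - algebraMap ℂ R (h f) ∈ RingHom.ker h := by simp [RingHom.mem_ker]
  have h2 : k (f - algebraMap ℂ R (h f)) = 0 := e h1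
  rw [map_sub, AlgHom.commutes, sub_eq_zero] at h2
  exact h2.symm

lemma exists_algHom_ne_zero [Algebra.FiniteType ℂ R] {f : R} (hf : ¬ IsNilpotent f) :
    ∃ h : R →ₐ[ℂ] ℂ, h f ≠ 0 := by
  by_contra! hall
  have : IsJacobsonRing R := isJacobsonRing_of_finiteType (A := ℂ)
  apply hf
  have hrad : (nilradical R).IsRadical := Ideal.radical_isRadical _
  rw [← mem_nilradical, ← IsJacobsonRing.out this hrad, Ideal.jacobson, Submodule.mem_sInf]
  rintro M ⟨-, hM⟩
  obtain ⟨h, rfl⟩ := exists_algHom_ker_eq M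
  exact hall h

/-- The image on complex points of a morphism of affine schemes of finite type contains a
principal open subset of the closure of the image. -/
lemma exists_forall_ne_zero_exists_comp [Algebra.FiniteType ℂ R] {B : Type*} [CommRing B]
    [IsDomain B] [Algebra ℂ B] [Algebra.FiniteType ℂ B] (φ : R →ₐ[ℂ] B) :
    ∃ c : R, φ c ≠ 0 ∧ ∀ h : R →ₐ[ℂ] ℂ, RingHom.ker φ ≤ RingHom.ker h → h c ≠ 0 →
      ∃ k : B →ₐ[ℂ] ℂ, h = k.comp φ := by
  have : IsNoetherianRing R := Algebra.FiniteType.isNoetherianRing ℂ R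
  have hfin : φ.toRingHom.FinitePresentation := by
    rw [← RingHom.FinitePresentation.of_finiteType]
    refine RingHom.FiniteType.of_comp_finiteType (f := algebraMap ℂ R) ?_
    rw [AlgHom.toRingHom_eq_coe, φ.comp_algebraMap, RingHom.finiteType_algebraMap]
    infer_instance
  obtain ⟨S, hS⟩ := PrimeSpectrum.exists_constructibleSetData_iff.2
    (PrimeSpectrum.isConstructible_range_comap hfin)
  -- The piece of the constructible image containing the generic point has all its equations in `ker
  -- φ`, so it is a principal open subset of the closure.
  have hgen : PrimeSpectrum.comap φ.toRingHom ⟨⊥, Ideal.isPrime_bot⟩ ∈ S.toSet :=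
    hS ▸ ⟨_, rfl⟩
  obtain ⟨C, hCS, hC1, hC2⟩ : ∃ C ∈ S, (∀ i, φ (C.g i) = 0) ∧ φ C.f ≠ 0 := by
    simp only [PrimeSpectrum.ConstructibleSetData.toSet, Set.mem_iUnion] at hgen
    obtain ⟨C, hCS, hC⟩ := hgen
    refine ⟨C, hCS, fun i ↦ ?_, fun h0 ↦ hC.2 ?_⟩
    · simpa using hC.1 ⟨i, rfl⟩
    · simpa [PrimeSpectrum.mem_zeroLocus] using h0
  refine ⟨C.f, hC2, fun h hker hne ↦ ?_⟩
  have hmem : (⟨RingHom.ker h, RingHom.ker_isPrime h⟩ : PrimeSpectrum R) ∈ S.toSet := by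
    simp only [PrimeSpectrum.ConstructibleSetData.toSet, Set.mem_iUnion]
    refine ⟨C, hCS, ?_, fun h0 ↦ hne ?_⟩
    · rintro _ ⟨i, rfl⟩
      exact hker (hC1 i)
    · simpa [PrimeSpectrum.mem_zeroLocus] using h0
  rw [hS] at hmem
  obtain ⟨P, hP⟩ := hmem
  -- The preimage found may not be closed; a maximal ideal above it still lies over `h`, because
  -- `ker h` is maximal.
  obtain ⟨M, hM, hPM⟩ := Ideal.exists_le_maximal P.asIdeal P.2.ne_top
  obtain ⟨k, hk⟩ := exists_algHom_ker_eq M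
  refine ⟨k, algHom_eq_of_ker_le fun f hf ↦ ?_⟩
  have h1 : f ∈ (PrimeSpectrum.comap φ.toRingHom P).asIdeal := by rw [hP]; exact hf
  have h2 : φ f ∈ RingHom.ker k := hk ▸ hPM h1
  exact h2

end ComplexPoints

/-! ### Subgroups containing a nonempty open set. -/

section OpenSubgroup

variable {H : Type*} [CommRing H] [HopfAlgebra ℂ H]

/-- In a connected algebraic group, a subgroup of the complex points that contains a nonempty open
subset is the whole group. -/
theorem eq_top_of_forall_ne_zero_mem [Algebra.FiniteType ℂ H] [ConnectedSpace (PrimeSpectrum H)]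
    (S : Subgroup (Points H ℂ)) {c : H} {s : Points H ℂ} (hs : s c ≠ 0)
    (hc : ∀ h : Points H ℂ, h c ≠ 0 → h ∈ S) : S = ⊤ := by
  let U : Points H ℂ → PrimeSpectrum H := fun h ↦ ⟨RingHom.ker h.ofConv, RingHom.ker_isPrime _⟩
  -- A translate of `c` that is nonzero at `h`; on its nonvanishing locus, membership in `S` is
  -- constant.
  let t : Points H ℂ → H := fun h ↦ leftTrans (s * h⁻¹).toDual c
  have ht : ∀ h k : Points H ℂ, k (t h) = (s * h⁻¹ * k) c := fun h k ↦
    (Points.mul_apply_left _ _ _).symm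
  have hself : ∀ h : Points H ℂ, h (t h) ≠ 0 := fun h ↦ by rw [ht]; simpa using hs
  have hsS : s ∈ S := hc s hs
  have hiff : ∀ h k : Points H ℂ, k (t h) ≠ 0 → (k ∈ S ↔ h ∈ S) := by
    intro h k hk
    rw [ht] at hk
    have h1 := hc _ hk
    rw [mul_assoc, S.mul_mem_cancel_left hsS] at h1
    constructor
    · intro hkS
      rw [S.mul_mem_cancel_right hkS] at h1
      exact inv_mem_iff.1 h1
    · intro hhS
      exact (S.mul_mem_cancel_left (inv_mem hhS)).1 h1
  -- These open sets, for `S` and its complement, partition the spectrum: closed points suffice for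
  -- covering, and an overlap would contain a complex point.
  let V : Set (Points H ℂ) → Set (PrimeSpectrum H) := fun T ↦
    ⋃ h ∈ T, (PrimeSpectrum.basicOpen (t h) : Set (PrimeSpectrum H))
  have hVopen : ∀ T, IsOpen (V T) := fun T ↦
    isOpen_biUnion fun h _ ↦ (PrimeSpectrum.basicOpen (t h)).2
  have hcover : V S ∪ V (Sᶜ : Set (Points H ℂ)) = Set.univ := by
    rw [Set.eq_univ_iff_forall]
    intro P
    obtain ⟨M, hM, hPM⟩ := Ideal.exists_le_maximal P.asIdeal P.2.ne_top
    obtain ⟨k, hk⟩ := exists_algHom_ker_eq M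
    have hP : P ∈ (PrimeSpectrum.basicOpen (t (toConv k)) : Set (PrimeSpectrum H)) := by
      intro hmem
      have h1 : t (toConv k) ∈ RingHom.ker k := hk ▸ hPM hmem
      exact hself (toConv k) h1
    by_cases hkS : toConv k ∈ S
    · exact Or.inl (Set.mem_biUnion (x := toConv k) hkS hP)
    · exact Or.inr (Set.mem_biUnion (x := toConv k) hkS hP)
  have hdisj : V S ∩ V (Sᶜ : Set (Points H ℂ)) = ∅ := by
    rw [Set.eq_empty_iff_forall_notMem]
    rintro P ⟨hP1, hP2⟩
    obtain ⟨h, hh, hPh⟩ := Set.mem_iUnion₂.1 hP1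
    obtain ⟨k, hk, hPk⟩ := Set.mem_iUnion₂.1 hP2
    have hnil : ¬ IsNilpotent (t h * t k) := by
      intro hn
      rcases P.2.mem_or_mem (nilpotent_iff_mem_prime.1 hn P.asIdeal P.2) with h1 | h1
      · exact hPh h1
      · exact hPk h1
    obtain ⟨l, hl⟩ := exists_algHom_ne_zero hnil
    rw [map_mul, mul_ne_zero_iff] at hl
    exact hk ((hiff k (toConv l) hl.2).1 ((hiff h (toConv l) hl.1).2 hh))
  have hclopen : IsClopen (V S) := by
    refine ⟨?_, hVopen _⟩
    rw [← isOpen_compl_iff]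
    have : (V S)ᶜ = V (Sᶜ : Set (Points H ℂ)) :=
      (IsCompl.of_eq hdisj hcover).compl_eq
    rw [this]
    exact hVopen _
  have hne : (V S).Nonempty := ⟨U s, Set.mem_biUnion (x := s) hsS (hself s)⟩
  have huniv := hclopen.eq_univ hne
  rw [Subgroup.eq_top_iff']
  intro h
  have hmem : U h ∈ V S := by rw [huniv]; trivial
  obtain ⟨k, hk, hkh⟩ := Set.mem_iUnion₂.1 hmem
  exact (hiff k h hkh).2 hk

end OpenSubgroup

/-! ### Points reached by morphisms from `Spec A`. -/

section Reachable

variable {H : Type*} [CommRing H] [HopfAlgebra ℂ H] {A : Type*} [CommRing A] [Algebra ℂ A]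

variable (H) in
/-- The complex points of the group that are the value at `q` of a morphism `Spec A → G` taking `p`
to the identity. -/
def reachable (p q : A →ₐ[ℂ] ℂ) : Subgroup (Points H ℂ) where
  carrier := {g | ∃ γ : Points H A, Points.map H p γ = 1 ∧ Points.map H q γ = g}
  one_mem' := ⟨1, Points.map_one p, Points.map_one q⟩
  mul_mem' := by
    rintro _ _ ⟨γ, hγ, rfl⟩ ⟨δ, hδ, rfl⟩
    exact ⟨γ * δ, by rw [Points.map_mul, hγ, hδ, mul_one], Points.map_mul q γ δ⟩
  inv_mem' := by
    rintro _ ⟨γ, hγ, rfl⟩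
    refine ⟨toConv (γ.ofConv.comp (HopfAlgebra.antipodeAlgHom ℂ H)), ?_, rfl⟩
    change (Points.map H p γ)⁻¹ = 1
    rw [hγ, inv_one]

lemma mem_reachable {p q : A →ₐ[ℂ] ℂ} {g : Points H ℂ} :
    g ∈ reachable H p q ↔ ∃ γ : Points H A, Points.map H p γ = 1 ∧ Points.map H q γ = g := Iff.rfl

lemma exists_eq_zero_eq_one {p q : A →ₐ[ℂ] ℂ} (hpq : p ≠ q) : ∃ a : A, p a = 0 ∧ q a = 1 := by
  obtain ⟨a, ha⟩ : ∃ a, p a ≠ q a := by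
    by_contra! h
    exact hpq (AlgHom.ext h)
  have hne : q a - p a ≠ 0 := sub_ne_zero.2 ha.symm
  refine ⟨(q a - p a)⁻¹ • (a - algebraMap ℂ A (p a)), ?_, ?_⟩
  · simp
  · simp [hne]

/-- Scaling the parameters by a function with value `0` at `p` and `1` at `q` interpolates between
`1` and the given product. -/
lemma nilExpProd_mem_reachable {p q : A →ₐ[ℂ] ℂ} (hpq : p ≠ q) {N : ℕ} (y : Fin N → NilElement H)
    (s : Fin N → ℂ) : nilExpProd y s ∈ reachable H p q := by
  obtain ⟨a, hp, hq⟩ := exists_eq_zero_eq_one hpq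
  refine ⟨nilExpProd y fun i ↦ s i • a, ?_, ?_⟩
  · rw [map_nilExpProd]
    simp [hp, nilExpProd_zero]
  · rw [map_nilExpProd]
    simp [hq]

lemma exists_basis_nilElement [FiniteDimensional ℂ (lieAlg H)] (h : nilSpan H = ⊤) :
    ∃ (N : ℕ) (b : Module.Basis (Fin N) ℂ (lieAlg H)) (y : Fin N → NilElement H),
      ∀ i, (y i).1 = b i := by
  obtain ⟨t, ht, hspan, hli⟩ := exists_linearIndependent ℂ {y : lieAlg H | IsLocNilpotent y.1}
  let b : Module.Basis t ℂ (lieAlg H) := Module.Basis.mk hli (by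
    rw [Subtype.range_coe, hspan]
    exact h.ge)
  have : Fintype t := FiniteDimensional.fintypeBasisIndex b
  refine ⟨_, b.reindex (Fintype.equivFin t), fun i ↦ ⟨(Fintype.equivFin t).symm i, ht ?_⟩, ?_⟩
  · exact Subtype.prop _
  · intro i
    simp [b]

theorem reachable_eq_top [Algebra.FiniteType ℂ H] [ConnectedSpace (PrimeSpectrum H)]
    (h : nilSpan H = ⊤) {p q : A →ₐ[ℂ] ℂ} (hpq : p ≠ q) : reachable H p q = ⊤ := by
  have := finiteDimensional_lieAlg (H := H)
  obtain ⟨N, b, y, hy⟩ := exists_basis_nilElement h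
  obtain ⟨r, hr, hker⟩ := exists_mul_eq_zero_of_nilExpProd_eq_zero b y hy
  set γ : Points H (MvPolynomial (Fin N) ℂ) := nilExpProd y fun i ↦ MvPolynomial.X i with hγ
  obtain ⟨c, hc, himage⟩ := exists_forall_ne_zero_exists_comp γ.ofConv
  -- At the origin of parameter space this polynomial takes the value `r(1) = 1`.
  have hγr : γ r ≠ 0 := by
    intro h0
    have h1 := map_nilExpProd (MvPolynomial.aeval fun _ : Fin N ↦ (0 : ℂ)) y MvPolynomial.X
    simp only [MvPolynomial.aeval_X, nilExpProd_zero] at h1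
    have h2 : MvPolynomial.aeval (fun _ : Fin N ↦ (0 : ℂ)) (γ r) = counit (R := ℂ) r :=
      congrArg (fun g : Points H ℂ ↦ g r) h1
    rw [h0, map_zero, hr] at h2
    exact zero_ne_one h2
  have hne : γ (r * c) ≠ 0 := by
    rw [map_mul]
    exact mul_ne_zero hγr hc
  obtain ⟨k, hk⟩ := exists_algHom_ne_zero (R := MvPolynomial (Fin N) ℂ) (f := γ (r * c))
    (fun hn ↦ hne hn.eq_zero)
  refine eq_top_of_forall_ne_zero_mem (c := r * c) (s := Points.map H k γ) _ hk fun g hg ↦ ?_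
  rw [map_mul, mul_ne_zero_iff] at hg
  -- Where `r` is nonzero, `r * f = 0` forces every `f` killed by the parametrization to vanish, so
  -- `g` lies in the closure of the image.
  obtain ⟨l, hl⟩ := himage g.ofConv (fun f hf ↦ by
    have := congrArg g.ofConv (hker f hf)
    rw [map_mul, map_zero] at this
    exact (mul_eq_zero.1 this).resolve_left hg.1) hg.2
  have hg' : g = Points.map H l γ := WithConv.ext hl
  rw [hg', hγ, map_nilExpProd]
  exact nilExpProd_mem_reachable hpq y _

end Reachable

end AffineNodal

theorem lemma3p1 {A : Type*} [CommRing A] [Algebra ℂ A] (hA : AffineNodal.IsNodalCurve A)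
    (p q : A →ₐ[ℂ] ℂ) (hpq : p ≠ q)
    (hp : AffineNodal.IsSmoothPoint p) (hq : AffineNodal.IsSmoothPoint q)
    {H : Type*} [CommRing H] [HopfAlgebra ℂ H] (hG : AffineNodal.IsSemisimple H)
    (g : AffineNodal.Points H ℂ) :
    ∃ γ : AffineNodal.Points H A,
      AffineNodal.Points.map H p γ = 1 ∧ AffineNodal.Points.map H q γ = g := by
  have := hG.smooth
  have := hG.connected
  have : Algebra.FiniteType ℂ H := inferInstance
  have := AffineNodal.finiteDimensional_lieAlg (H := H)
  have := AffineNodal.hasTrivialRadical_lieAlg hG.radical_trivial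
  rw [← AffineNodal.mem_reachable,
    AffineNodal.reachable_eq_top AffineNodal.nilSpan_eq_top hpq]
  trivial
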